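/- Notation: $\mathbb N=\{0,1,2,\dots\}$; for an integer $m\ge 1$, $I_m=\{(j,\alpha)\in\mathbb N^2 : j+\alpha\le m,\ j<m\}$; $[\rho]_0=1$ and $[\rho]_\beta=\rho(\rho-1)\cdots(\rho-\beta+1)$ for $\beta\ge1$. Let $c_{j,\alpha}\le 0$ be real numbers $((j,\alpha)\in I_m)$, and put $$L(\lambda,\rho)=\lambda^m-\sum_{(j,\alpha)\in I_m}c_{j,\alpha}\,\lambda^j[\rho]_\alpha .$$ The Newton polygon $\mathcal N_0\subset\mathbb R^2$ of $L$ is the convex hull of the union of the quadrants $\{(x,y) : x\le j,\ y\le\alpha\}$ over $(j,\alpha)\in\{(m,0)\}\cup\{(j,\alpha)\in I_m : c_{j,\alpha}\ne0\}$. For real $s,\sigma\ge1$, a formal series $\sum_{k,l\ge0}a_{k,l}t^kx^l\in\mathbb C[[t,x]]$ belongs to $G\{t,x\}_{(s,\sigma)}$ if the power series $\sum_{k,l}\frac{a_{k,l}}{k!^{\,s-1}\,l!^{\,\sigma-1}}t^kx^l$ converges in a neighbourhood of $(0,0)\in\mathbb C^2$. Let $A,B,C>0$; let $p,q,\mu\in\mathbb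 N$ with $p\ge1$, $q\ge1$, $0\le\mu<m$; let $(h,\beta)\in I_m$ with $(h,\beta)\notin\mathcal N_0$; let $(j,\alpha)\in I_m$ with $\alpha>\mu$. Set $d=\min\{y\in\mathbb R : (h,\beta-y)\in\mathcal N_0\}$ and $$\sigma_0^*=1+\frac dp,\qquad s_0^*=1+\max\Bigl[0,\ \frac{j+\alpha+(d/p)(\alpha-\mu)-m}{q}\Bigr].$$ (1) The equation $$L(t\partial_t,x\partial_x)u=Ax^mt+Bx^p(t\partial_t)^h[x\partial_x]_\beta u+Ct^qx^\mu(t\partial_t)^j\partial_x^\alpha u$$ has a unique formal solution $u(t,x)\in\mathbb C[[t,x]]$ with $u(0,x)\equiv0$, and for all real $s\ge1$, $\sigma\ge1$ one has $u\in G\{t,x\}_{(s,\sigma)}$ if and only if $s\ge s_0^*$ and $\sigma\ge\sigma_0^*$. (2) The same holds, with the same $s_0^*$ and $\sigma_0^*$, for the equation $$L(t\partial_t,x\partial_x)u=Axt+Bx^p(t\partial_t)^h(x\partial_x)^\beta u+Ct^qx^\mu(t\partial_t)^j\partial_x^\alpha u .$$ -/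

import Mathlib

open scoped Topology Nat

noncomputable section

namespace FormalGevrey

/-- The ring `ℂ[[t, x]]` of formal power series; index `0` is the variable `t`, index `1` is `x`. -/
abbrev Series : Type := MvPowerSeries (Fin 2) ℂ

/-- The exponent of the monomial `t ^ k * x ^ l`. -/
def expo (k l : ℕ) : Fin 2 →₀ ℕ := Finsupp.single 0 k + Finsupp.single 1 l

/-- The coefficient of `t ^ k * x ^ l` in `u`. -/
def cf (u : Series) (k l : ℕ) : ℂ := MvPowerSeries.coeff (expo k l) u

/-- The variable `t` as a formal series. -/
def tvar : Series := MvPowerSeries.X 0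

/-- The variable `x` as a formal series. -/
def xvar : Series := MvPowerSeries.X 1

/-- The operator `∂_t`. -/
def dt : Module.End ℂ Series := (MvPowerSeries.pderiv ℂ (0 : Fin 2)).toLinearMap

/-- The operator `∂_x`. -/
def dx : Module.End ℂ Series := (MvPowerSeries.pderiv ℂ (1 : Fin 2)).toLinearMap

/-- The operator `t ∂_t`. -/
def thetaT : Module.End ℂ Series := LinearMap.mulLeft ℂ tvar * dt

/-- The operator `x ∂_x`. -/
def thetaX : Module.End ℂ Series := LinearMap.mulLeft ℂ xvar * dx

/-- The operator `[x ∂_x]_b = (x ∂_x) (x ∂_x - 1) ⋯ (x ∂_x - b + 1)`, with `[x ∂_x]_0 = 1`. -/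
def fallX (b : ℕ) : Module.End ℂ Series := Polynomial.aeval thetaX (descPochhammer ℂ b)

/-- The index set `I_m` of the pairs `(j, a)` with `j + a ≤ m` and `j < m`. -/
def Im (m : ℕ) : Finset (ℕ × ℕ) :=
  (Finset.range m ×ˢ Finset.range (m + 1)).filter fun v => v.1 + v.2 ≤ m

/-- The operator `L(t ∂_t, x ∂_x)`, where
`L(X, Y) = X ^ m - ∑_{(j, a) ∈ I_m} c (j, a) X ^ j Y (Y - 1) ⋯ (Y - a + 1)`. -/
def opL (m : ℕ) (c : ℕ × ℕ → ℝ) : Module.End ℂ Series :=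
  thetaT ^ m - ∑ v ∈ Im m, (c v : ℂ) • (thetaT ^ v.1 * fallX v.2)

/-- The set `Λ₀`: the pair `(m, 0)` and the pairs of `I_m` with non-zero coefficient. -/
def Lam0 (m : ℕ) (c : ℕ × ℕ → ℝ) : Set (ℕ × ℕ) :=
  {(m, 0)} ∪ {v | v ∈ Im m ∧ c v ≠ 0}

/-- The Newton polygon of `L`: the convex hull in `ℝ²` of the union of the quadrants
`{(x, y) | x ≤ j, y ≤ a}`, where `(j, a)` runs through `Λ₀`. -/
def newtonPolygon (m : ℕ) (c : ℕ × ℕ → ℝ) : Set (ℝ × ℝ) :=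
  convexHull ℝ (⋃ v ∈ Lam0 m c, {z : ℝ × ℝ | z.1 ≤ (v.1 : ℝ) ∧ z.2 ≤ (v.2 : ℝ)})

/-- The number `d = min {y ∈ ℝ | (h, b - y) ∈ N₀}`, where `N₀` is the Newton polygon. -/
def height (m : ℕ) (c : ℕ × ℕ → ℝ) (h b : ℕ) : ℝ :=
  sInf {y : ℝ | ((h : ℝ), (b : ℝ) - y) ∈ newtonPolygon m c}

open scoped Pointwise in
/-- The infimum in the definition of `height` is a minimum. -/
theorem isLeast_height (m : ℕ) (c : ℕ × ℕ → ℝ) (h b : ℕ) (hh : h ≤ m) :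
    IsLeast {y : ℝ | ((h : ℝ), (b : ℝ) - y) ∈ newtonPolygon m c} (height m c h b) := by
  have hfin : (Lam0 m c).Finite :=
    (Set.finite_singleton _).union ((Im m).finite_toSet.subset fun v hv => hv.1)
  set f : ℕ × ℕ → ℝ × ℝ := fun v => ((v.1 : ℝ), (v.2 : ℝ)) with hf
  have hU : (⋃ v ∈ Lam0 m c, {z : ℝ × ℝ | z.1 ≤ (v.1 : ℝ) ∧ z.2 ≤ (v.2 : ℝ)})
      = f '' Lam0 m c + Set.Iic (0 : ℝ × ℝ) := by
    ext z
    simp only [Set.mem_iUnion, Set.mem_ofPred_eq, Set.mem_add, Set.mem_image, Set.mem_Iic]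
    constructor
    · rintro ⟨v, hv, h1, h2⟩
      refine ⟨f v, ⟨v, hv, rfl⟩, z - f v, ?_, by abel⟩
      exact ⟨by simpa [hf] using h1, by simpa [hf] using h2⟩
    · rintro ⟨_, ⟨v, hv, rfl⟩, w, ⟨h1, h2⟩, rfl⟩
      refine ⟨v, hv, ?_, ?_⟩
      · simpa [hf] using h1
      · simpa [hf] using h2
  have hclosed : IsClosed (newtonPolygon m c) := by
    rw [newtonPolygon, hU, convexHull_add, (convex_Iic (0 : ℝ × ℝ)).convexHull_eq]
    exact isClosed_Iic.add_left_of_isCompact ((hfin.image f).isCompact_convexHull ℝ)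
  have hle : newtonPolygon m c ⊆ {z : ℝ × ℝ | z.2 ≤ (m : ℝ)} := by
    refine convexHull_min ?_ (convex_halfSpace_le (LinearMap.snd ℝ ℝ ℝ).isLinear _)
    intro z hz
    simp only [Set.mem_iUnion, Set.mem_ofPred_eq] at hz ⊢
    obtain ⟨v, hv, -, h2⟩ := hz
    refine h2.trans ?_
    rcases hv with rfl | ⟨hv, -⟩
    · simp
    · simp only [Im, Finset.mem_filter] at hv
      exact_mod_cast (by omega : v.2 ≤ m)
  have hne : ((b : ℝ)) ∈ {y : ℝ | ((h : ℝ), (b : ℝ) - y) ∈ newtonPolygon m c} := by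
    refine subset_convexHull ℝ _ ?_
    simp only [Set.mem_iUnion, Set.mem_ofPred_eq]
    refine ⟨(m, 0), Or.inl rfl, ?_, by simp⟩
    exact_mod_cast hh
  have hbdd : BddBelow {y : ℝ | ((h : ℝ), (b : ℝ) - y) ∈ newtonPolygon m c} := by
    refine ⟨(b : ℝ) - m, fun y hy => ?_⟩
    have := hle hy
    simp only [Set.mem_ofPred_eq] at this
    linarith
  refine ⟨IsClosed.csInf_mem ?_ ⟨_, hne⟩ hbdd, fun y hy => csInf_le hbdd hy⟩
  exact hclosed.preimage (by fun_prop : Continuous fun y : ℝ => ((h : ℝ), (b : ℝ) - y))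

/-- The formal Gevrey class `G{t, x}_{(s, σ)}` (for `s ≥ 1`, `σ ≥ 1`): the power series
`∑ u_{k,l} / (k!^(s-1) l!^(σ-1)) t^k x^l` converges in a neighbourhood of `(0, 0)` in `ℂ²`. -/
def InGevrey (s σ : ℝ) (u : Series) : Prop :=
  ∀ᶠ z : ℂ × ℂ in 𝓝 0, Summable fun n : ℕ × ℕ =>
    cf u n.1 n.2 / (((((n.1)! : ℝ) ^ (s - 1) * ((n.2)! : ℝ) ^ (σ - 1) : ℝ)) : ℂ)
      * z.1 ^ n.1 * z.2 ^ n.2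

/-- The right-hand side
`A x^m t + B x^p (t ∂_t)^h [x ∂_x]_β u + C t^q x^μ (t ∂_t)^j ∂_x^α u`. -/
def modelRhs (m : ℕ) (A B C : ℝ) (p q μ h β j α : ℕ) (u : Series) : Series :=
  (A : ℂ) • (xvar ^ m * tvar)
    + (B : ℂ) • (xvar ^ p * (thetaT ^ h * fallX β) u)
    + (C : ℂ) • (tvar ^ q * xvar ^ μ * (thetaT ^ j * dx ^ α) u)

/-- The right-hand side
`A x t + B x^p (t ∂_t)^h (x ∂_x)^β u + C t^q x^μ (t ∂_t)^j ∂_x^α u`. -/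
def variantRhs (A B C : ℝ) (p q μ h β j α : ℕ) (u : Series) : Series :=
  (A : ℂ) • (xvar * tvar)
    + (B : ℂ) • (xvar ^ p * (thetaT ^ h * thetaX ^ β) u)
    + (C : ℂ) • (tvar ^ q * xvar ^ μ * (thetaT ^ j * dx ^ α) u)

/-- `u` is a formal solution of `L(t ∂_t, x ∂_x) u = rhs u` with `u(0, x) ≡ 0`. -/
def IsFormalSolution (m : ℕ) (c : ℕ × ℕ → ℝ) (rhs : Series → Series) (u : Series) : Prop :=
  (∀ l : ℕ, cf u 0 l = 0) ∧ opL m c u = rhs u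

/-- The index `σ₀* = 1 + d / p`. -/
def sigmaStar (m : ℕ) (c : ℕ × ℕ → ℝ) (p h β : ℕ) : ℝ :=
  1 + height m c h β / p

/-- The index `s₀* = 1 + max [0, (j + α + (d / p) (α - μ) - m) / q]`. -/
def sStar (m : ℕ) (c : ℕ × ℕ → ℝ) (p q μ h β j α : ℕ) : ℝ :=
  1 + max 0 (((j : ℝ) + α + height m c h β / p * ((α : ℝ) - μ) - m) / q)

end FormalGevrey

end

/-!
The coefficients of a formal solution satisfy `L(k, l) a k l = f k l + (terms from earlier indices)`
with `L(k, l) > 0` for `k ≥ 1`, so the solution exists and is unique, and all its coefficients are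
non-negative.

For the upper bound, a multiple of a weight `ρ ^ (k + l) k!^e l!^e'`, with `k!^e` partly replaced by
a rising factorial, is a supersolution. The term `x ^ p (t ∂_t) ^ h [x ∂_x]_β` gains `k ^ h l ^ β`,
and since `(h, β - d)` lies in the Newton polygon this is `O(l ^ d L(k, l))`: a power `l!^(d / p)`
absorbs the excess. The remaining term trades `δ = α - μ` powers of `x` for `q` powers of `t`, which
fixes the power of `k!`.

For the lower bound, positivity allows us to follow a single path of indices and discard everything
else. A line supporting the Newton polygon above `(h, β - d)` has a slope `κ ∈ [0, 1)` such that
`L(k, l) ≲ r ^ (κ h + β - d)` along `k ∼ r ^ κ`, `l ∼ r`. Starting from the source, about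
`⌊r ^ κ⌋` steps of each kind raise `k` to this size at subexponential cost. Then `δ r` steps of the
term with `x ^ p` produce the growth `r!^(δ d)` in the direction of `x`, and `p r` further steps of
the term with `t ^ q` transport it back to bounded `l`, that is, into the direction of `t`.
-/

open Filter

noncomputable section

namespace FormalGevrey

/-! ### Coefficients of formal series -/

theorem expo_eq_iff {n : Fin 2 →₀ ℕ} {k l : ℕ} : expo k l = n ↔ k = n 0 ∧ l = n 1 := by
  simp [Finsupp.ext_iff, expo]

theorem series_ext {u v : Series} (h : ∀ k l, cf u k l = cf v k l) : u = v := by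
  ext n
  rw [← (expo_eq_iff (n := n)).2 ⟨rfl, rfl⟩]
  exact h (n 0) (n 1)

theorem cf_ofCoeffs (a : ℕ → ℕ → ℂ) (k l : ℕ) : cf (fun n => a (n 0) (n 1)) k l = a k l := by
  obtain ⟨hk, hl⟩ := expo_eq_iff.1 (rfl : expo k l = expo k l)
  change a (expo k l 0) (expo k l 1) = a k l
  rw [← hk, ← hl]

theorem cf_add (u v : Series) (k l : ℕ) : cf (u + v) k l = cf u k l + cf v k l := map_add _ _ _

theorem cf_smul (a : ℂ) (u : Series) (k l : ℕ) : cf (a • u) k l = a * cf u k l := map_smul _ a u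

theorem cf_tvar_pow_mul (q : ℕ) (u : Series) (k l : ℕ) :
    cf (tvar ^ q * u) k l = if q ≤ k then cf u (k - q) l else 0 := by
  have hle : Finsupp.single 0 q ≤ expo k l ↔ q ≤ k := by simp [expo]
  have hsub : expo k l - Finsupp.single 0 q = expo (k - q) l :=
    (expo_eq_iff.2 (by simp [expo])).symm
  simp only [cf, tvar, MvPowerSeries.X_pow_eq, MvPowerSeries.coeff_monomial_mul, hsub, hle, one_mul]

theorem cf_xvar_pow_mul (p : ℕ) (u : Series) (k l : ℕ) :
    cf (xvar ^ p * u) k l = if p ≤ l then cf u k (l - p) else 0 := by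
  have hle : Finsupp.single 1 p ≤ expo k l ↔ p ≤ l := by simp [expo]
  have hsub : expo k l - Finsupp.single 1 p = expo k (l - p) :=
    (expo_eq_iff.2 (by simp [expo])).symm
  simp only [cf, xvar, MvPowerSeries.X_pow_eq, MvPowerSeries.coeff_monomial_mul, hsub, hle, one_mul]

theorem cf_xvar_pow_mul_tvar (n k l : ℕ) :
    cf (xvar ^ n * tvar) k l = if k = 1 ∧ l = n then 1 else 0 := by
  have hmon : (xvar ^ n * tvar : Series) = MvPowerSeries.monomial (expo 1 n) 1 := by
    rw [xvar, tvar, MvPowerSeries.X_pow_eq, MvPowerSeries.X, MvPowerSeries.monomial_mul_monomial,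
      expo, add_comm, one_mul]
  have hexpo : expo k l = expo 1 n ↔ k = 1 ∧ l = n := by
    rw [expo_eq_iff]
    simp [expo]
  simp only [hmon, cf, MvPowerSeries.coeff_monomial, hexpo]

theorem cf_dt (u : Series) (k l : ℕ) : cf (dt u) k l = (k + 1) * cf u (k + 1) l := by
  have hadd : expo k l + Finsupp.single 0 1 = expo (k + 1) l :=
    (expo_eq_iff.2 (by simp [expo])).symm
  have hcoeff := MvPowerSeries.coeff_pderiv (i := (0 : Fin 2)) u (expo k l)
  rw [hadd, show expo k l 0 = k by simp [expo], mul_comm] at hcoeff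
  exact hcoeff

theorem cf_dx (u : Series) (k l : ℕ) : cf (dx u) k l = (l + 1) * cf u k (l + 1) := by
  have hadd : expo k l + Finsupp.single 1 1 = expo k (l + 1) :=
    (expo_eq_iff.2 (by simp [expo])).symm
  have hcoeff := MvPowerSeries.coeff_pderiv (i := (1 : Fin 2)) u (expo k l)
  rw [hadd, show expo k l 1 = l by simp [expo], mul_comm] at hcoeff
  exact hcoeff

theorem cf_thetaT (u : Series) (k l : ℕ) : cf (thetaT u) k l = k * cf u k l := by
  have htheta : thetaT u = tvar ^ 1 * dt u := by simp [thetaT]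
  rw [htheta, cf_tvar_pow_mul]
  cases k <;> simp [cf_dt]

theorem cf_thetaX (u : Series) (k l : ℕ) : cf (thetaX u) k l = l * cf u k l := by
  have htheta : thetaX u = xvar ^ 1 * dx u := by simp [thetaX]
  rw [htheta, cf_xvar_pow_mul]
  cases l <;> simp [cf_dx]

theorem cf_thetaT_pow (n : ℕ) (u : Series) (k l : ℕ) :
    cf ((thetaT ^ n) u) k l = (k : ℂ) ^ n * cf u k l := by
  induction n with
  | zero => simp
  | succ n ih => rw [pow_succ', Module.End.mul_apply, cf_thetaT, ih, pow_succ', mul_assoc]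

theorem cf_thetaX_pow (n : ℕ) (u : Series) (k l : ℕ) :
    cf ((thetaX ^ n) u) k l = (l : ℂ) ^ n * cf u k l := by
  induction n with
  | zero => simp
  | succ n ih => rw [pow_succ', Module.End.mul_apply, cf_thetaX, ih, pow_succ', mul_assoc]

theorem cf_aeval_thetaX (P : Polynomial ℂ) (u : Series) (k l : ℕ) :
    cf (Polynomial.aeval thetaX P u) k l = P.eval (l : ℂ) * cf u k l := by
  induction P using Polynomial.induction_on' with
  | add P Q hP hQ =>
    rw [map_add, LinearMap.add_apply, cf_add, hP, hQ, Polynomial.eval_add, add_mul]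
  | monomial n a =>
    rw [Polynomial.aeval_monomial, Module.End.mul_apply, Module.algebraMap_end_apply, cf_smul,
      cf_thetaX_pow, Polynomial.eval_monomial, mul_assoc]

theorem cf_fallX (n : ℕ) (u : Series) (k l : ℕ) :
    cf (fallX n u) k l = (l.descFactorial n : ℂ) * cf u k l := by
  rw [fallX, cf_aeval_thetaX, descPochhammer_eval_eq_descFactorial]

theorem cf_dx_pow (n : ℕ) (u : Series) (k l : ℕ) :
    cf ((dx ^ n) u) k l = ((l + n).descFactorial n : ℂ) * cf u k (l + n) := by
  induction n generalizing l with
  | zero => simp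
  | succ n ih =>
    have hfall : (l + (n + 1)).descFactorial (n + 1) = (l + 1) * (l + 1 + n).descFactorial n := by
      simp only [Nat.add_descFactorial_eq_ascFactorial, Nat.ascFactorial, ← Nat.succ_ascFactorial]
    rw [pow_succ', Module.End.mul_apply, cf_dx, ih, hfall, Nat.cast_mul, Nat.cast_succ, mul_assoc,
      add_right_comm, add_assoc]

theorem cf_shift_thetaT_pow_mul_dx_pow (q μ j α : ℕ) (u : Series) (k l : ℕ) :
    cf (tvar ^ q * xvar ^ μ * (thetaT ^ j * dx ^ α) u) k l
      = if q ≤ k ∧ μ ≤ l then ((k - q : ℕ) : ℂ) ^ j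
        * ((l - μ + α).descFactorial α * cf u (k - q) (l - μ + α)) else 0 := by
  rw [mul_assoc, cf_tvar_pow_mul, cf_xvar_pow_mul, Module.End.mul_apply, cf_thetaT_pow, cf_dx_pow,
    ite_and]

/-! ### The symbol of the operator -/

theorem mem_Im {m j a : ℕ} : (j, a) ∈ Im m ↔ j < m ∧ j + a ≤ m := by
  simp only [Im, Finset.mem_filter, Finset.mem_product, Finset.mem_range]
  omega

theorem le_of_mem_Lam0 {m : ℕ} {c : ℕ × ℕ → ℝ} {v : ℕ × ℕ} (hv : v ∈ Lam0 m c) :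
    v.1 + v.2 ≤ m := by
  rcases hv with rfl | ⟨hv, -⟩
  · rfl
  · exact (mem_Im.1 hv).2

/-- The value `L(k, l)` of the polynomial `L` at a pair of natural numbers. -/
def symbol (m : ℕ) (c : ℕ × ℕ → ℝ) (k l : ℕ) : ℝ :=
  (k : ℝ) ^ m - ∑ v ∈ Im m, c v * ((k : ℝ) ^ v.1 * l.descFactorial v.2)

theorem cf_opL (m : ℕ) (c : ℕ × ℕ → ℝ) (u : Series) (k l : ℕ) :
    cf (opL m c u) k l = symbol m c k l * cf u k l := by
  have hsum : cf ((∑ v ∈ Im m, (c v : ℂ) • (thetaT ^ v.1 * fallX v.2)) u) k l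
      = ∑ v ∈ Im m, (c v : ℂ) * ((k : ℂ) ^ v.1 * l.descFactorial v.2) * cf u k l := by
    rw [LinearMap.sum_apply, cf, map_sum]
    refine Finset.sum_congr rfl fun v _ => ?_
    rw [← cf, LinearMap.smul_apply, Module.End.mul_apply, cf_smul, cf_thetaT_pow, cf_fallX]
    ring
  have hsub : cf (opL m c u) k l = cf ((thetaT ^ m) u) k l
      - cf ((∑ v ∈ Im m, (c v : ℂ) • (thetaT ^ v.1 * fallX v.2)) u) k l := map_sub _ _ _
  rw [hsub, hsum, cf_thetaT_pow, symbol, ← Finset.sum_mul]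
  push_cast
  ring

section SymbolBounds

variable {m : ℕ} {c : ℕ × ℕ → ℝ} (hc : ∀ v ∈ Im m, c v ≤ 0)

theorem symbol_eq_add (m : ℕ) (c : ℕ × ℕ → ℝ) (k l : ℕ) :
    symbol m c k l
      = (k : ℝ) ^ m + ∑ v ∈ Im m, -c v * ((k : ℝ) ^ v.1 * l.descFactorial v.2) := by
  simp only [symbol, sub_eq_add_neg, ← Finset.sum_neg_distrib, neg_mul]

include hc

theorem symbol_term_nonneg {v : ℕ × ℕ} (hv : v ∈ Im m) (k l : ℕ) :
    0 ≤ -c v * ((k : ℝ) ^ v.1 * l.descFactorial v.2) :=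
  mul_nonneg (neg_nonneg.2 (hc v hv)) (by positivity)

theorem pow_le_symbol (k l : ℕ) : (k : ℝ) ^ m ≤ symbol m c k l := by
  rw [symbol_eq_add]
  exact le_add_of_nonneg_right (Finset.sum_nonneg fun v hv => symbol_term_nonneg hc hv k l)

theorem symbol_term_le {v : ℕ × ℕ} (hv : v ∈ Im m) (k l : ℕ) :
    -c v * ((k : ℝ) ^ v.1 * l.descFactorial v.2) ≤ symbol m c k l := by
  rw [symbol_eq_add]
  exact (Finset.single_le_sum (fun v hv => symbol_term_nonneg hc hv k l) hv).trans
    (le_add_of_nonneg_left (by positivity))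

theorem symbol_pos {k : ℕ} (hk : 1 ≤ k) (l : ℕ) : 0 < symbol m c k l :=
  (pow_pos (by exact_mod_cast hk) m).trans_le (pow_le_symbol hc k l)

theorem symbol_mono {k k' l l' : ℕ} (hk : k ≤ k') (hl : l ≤ l') :
    symbol m c k l ≤ symbol m c k' l' := by
  simp only [symbol_eq_add]
  gcongr with v hv
  exact neg_nonneg.2 (hc v hv)

theorem exists_eventually_symbol_le {κ M a b : ℝ} (ha : 0 < a)
    (hM : ∀ v ∈ Lam0 m c, κ * v.1 + v.2 ≤ M) {k l : ℕ → ℕ}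
    (hk : ∀ᶠ r : ℕ in atTop, (k r : ℝ) ≤ a * (r : ℝ) ^ κ)
    (hl : ∀ᶠ r : ℕ in atTop, (l r : ℝ) ≤ b * r) :
    ∃ Y > 0, ∀ᶠ r : ℕ in atTop, symbol m c (k r) (l r) ≤ Y * (r : ℝ) ^ M := by
  refine ⟨a ^ m + ∑ v ∈ Im m, -c v * (a ^ v.1 * |b| ^ v.2), ?_, ?_⟩
  · exact add_pos_of_pos_of_nonneg (by positivity)
      (Finset.sum_nonneg fun v hv => mul_nonneg (neg_nonneg.2 (hc v hv)) (by positivity))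
  filter_upwards [hk, hl, eventually_ge_atTop 1] with r hkr hlr hr
  have hr1 : (1 : ℝ) ≤ r := by exact_mod_cast hr
  have hr0 : (0 : ℝ) < r := by positivity
  have hmonomial (v : ℕ × ℕ) (hv : v ∈ Lam0 m c) :
      (k r : ℝ) ^ v.1 * (l r).descFactorial v.2 ≤ a ^ v.1 * |b| ^ v.2 * (r : ℝ) ^ M := calc
    (k r : ℝ) ^ v.1 * (l r).descFactorial v.2 ≤ (k r : ℝ) ^ v.1 * (l r : ℝ) ^ v.2 := by
      gcongr
      exact_mod_cast Nat.descFactorial_le_pow _ _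
    _ ≤ (a * (r : ℝ) ^ κ) ^ v.1 * (|b| * r) ^ v.2 := by
      gcongr
      exact hlr.trans (by gcongr; exact le_abs_self b)
    _ = a ^ v.1 * |b| ^ v.2 * (r : ℝ) ^ (κ * v.1 + v.2) := by
      rw [mul_pow, mul_pow, Real.rpow_add hr0, Real.rpow_mul hr0.le, Real.rpow_natCast,
        Real.rpow_natCast]
      ring
    _ ≤ a ^ v.1 * |b| ^ v.2 * (r : ℝ) ^ M := by
      gcongr
      exact hM v hv
  rw [symbol_eq_add, add_mul, Finset.sum_mul]
  refine add_le_add ?_ (Finset.sum_le_sum fun v hv => ?_)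
  · simpa using hmonomial (m, 0) (Or.inl rfl)
  · rcases eq_or_ne (c v) 0 with hv0 | hv0
    · simp [hv0]
    · rw [mul_assoc]
      exact mul_le_mul_of_nonneg_left (hmonomial v (Or.inr ⟨hv, hv0⟩)) (neg_nonneg.2 (hc v hv))

omit hc in
theorem pow_le_mul_descFactorial {a l : ℕ} (hal : a ≤ l) : l ^ a ≤ a ^ a * l.descFactorial a := by
  obtain ⟨i, rfl⟩ := Nat.exists_eq_add_of_le hal
  rcases a with - | a
  · simp
  calc (a + 1 + i) ^ (a + 1) ≤ ((a + 1) * (a + 1 + i + 1 - (a + 1))) ^ (a + 1) := by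
        gcongr
        rw [show a + 1 + i + 1 - (a + 1) = i + 1 by omega]
        nlinarith
    _ = (a + 1) ^ (a + 1) * (a + 1 + i + 1 - (a + 1)) ^ (a + 1) := mul_pow _ _ _
    _ ≤ (a + 1) ^ (a + 1) * (a + 1 + i).descFactorial (a + 1) := by
        gcongr
        exact Nat.pow_sub_le_descFactorial _ _

omit hc in
theorem pow_le_mul_descFactorial_add_one (a l : ℕ) : l ^ a ≤ a ^ a * (l.descFactorial a + 1) := by
  rcases le_or_gt a l with hal | hla
  · exact (pow_le_mul_descFactorial hal).trans (Nat.mul_le_mul_left _ (Nat.le_succ _))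
  · exact (Nat.pow_le_pow_left hla.le a).trans (Nat.le_mul_of_pos_right _ (Nat.succ_pos _))

theorem exists_pow_mul_pow_le_symbol : ∃ K > 0, ∀ v ∈ Lam0 m c, ∀ k l : ℕ, 1 ≤ k →
    (k : ℝ) ^ v.1 * (l : ℝ) ^ v.2 ≤ K * symbol m c k l := by
  set T : ℕ × ℕ → ℝ := fun v => (v.2 : ℝ) ^ v.2 * (|c v|⁻¹ + 1)
  have hT (v : ℕ × ℕ) : 0 ≤ T v := by positivity
  have hsum : 0 ≤ ∑ v ∈ Im m, T v := Finset.sum_nonneg fun v _ => hT v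
  refine ⟨1 + ∑ v ∈ Im m, T v, by positivity, fun v hv k l hk => ?_⟩
  have hsymbol := symbol_pos hc hk l
  rcases hv with rfl | ⟨hv, hcv⟩
  · simpa using (pow_le_symbol hc k l).trans (le_mul_of_one_le_left hsymbol.le (by linarith))
  have hfall : (k : ℝ) ^ v.1 * l.descFactorial v.2 ≤ |c v|⁻¹ * symbol m c k l := by
    rw [← div_eq_inv_mul, le_div_iff₀' (abs_pos.2 hcv), abs_of_nonpos (hc v hv)]
    exact symbol_term_le hc hv k l
  have hpow : (k : ℝ) ^ v.1 ≤ symbol m c k l :=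
    (pow_le_pow_right₀ (by exact_mod_cast hk) (mem_Im.1 hv).1.le).trans (pow_le_symbol hc k l)
  calc (k : ℝ) ^ v.1 * (l : ℝ) ^ v.2
      ≤ (k : ℝ) ^ v.1 * ((v.2 : ℝ) ^ v.2 * (l.descFactorial v.2 + 1)) := by
        gcongr
        exact_mod_cast pow_le_mul_descFactorial_add_one v.2 l
    _ = (v.2 : ℝ) ^ v.2 * ((k : ℝ) ^ v.1 * l.descFactorial v.2 + (k : ℝ) ^ v.1) := by ring
    _ ≤ (v.2 : ℝ) ^ v.2 * (|c v|⁻¹ * symbol m c k l + symbol m c k l) := by gcongr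
    _ = T v * symbol m c k l := by ring
    _ ≤ (1 + ∑ v ∈ Im m, T v) * symbol m c k l := by
        gcongr
        linarith [Finset.single_le_sum (fun v _ => hT v) hv]

end SymbolBounds

/-! ### The Newton polygon -/

section NewtonPolygon

variable {m : ℕ} {c : ℕ × ℕ → ℝ}

theorem linear_le_of_mem_newtonPolygon {X Y M : ℝ} (hX : 0 ≤ X) (hY : 0 ≤ Y)
    (hM : ∀ v ∈ Lam0 m c, v.1 * X + v.2 * Y ≤ M) {z : ℝ × ℝ} (hz : z ∈ newtonPolygon m c) :
    z.1 * X + z.2 * Y ≤ M := by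
  have hconvex : Convex ℝ {z : ℝ × ℝ | z.1 * X + z.2 * Y ≤ M} :=
    convex_halfSpace_le (f := fun z : ℝ × ℝ => z.1 * X + z.2 * Y)
      ⟨fun a b => by simp only [Prod.fst_add, Prod.snd_add]; ring,
        fun a b => by simp only [Prod.smul_fst, Prod.smul_snd, smul_eq_mul]; ring⟩ M
  refine convexHull_min (Set.iUnion₂_subset ?_) hconvex hz
  rintro v hv w ⟨h₁, h₂⟩
  have hbound : w.1 * X + w.2 * Y ≤ v.1 * X + v.2 * Y := by gcongr
  exact hbound.trans (hM v hv)

open scoped Pointwise in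
theorem isLowerSet_convexHull {E : Type*} [AddCommGroup E] [Module ℝ E] [PartialOrder E]
    [IsOrderedAddMonoid E] [PosSMulMono ℝ E] {s : Set E} (hs : IsLowerSet s) :
    IsLowerSet (convexHull ℝ s) := by
  have hsum : s = s + Set.Iic (0 : E) := by
    refine (Set.subset_add_left s (Set.mem_Iic.2 le_rfl)).antisymm ?_
    rintro _ ⟨a, ha, b, hb, rfl⟩
    exact hs (add_le_of_nonpos_right hb) ha
  rw [hsum, convexHull_add, (convex_Iic (0 : E)).convexHull_eq]
  exact (isLowerSet_Iic 0).add_left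

theorem isLowerSet_newtonPolygon (m : ℕ) (c : ℕ × ℕ → ℝ) : IsLowerSet (newtonPolygon m c) :=
  isLowerSet_convexHull <| isLowerSet_iUnion₂ fun v _ =>
    isLowerSet_Iic ((v.1 : ℝ), (v.2 : ℝ))

theorem mem_newtonPolygon_of_mem_Lam0 {v : ℕ × ℕ} (hv : v ∈ Lam0 m c) :
    ((v.1 : ℝ), (v.2 : ℝ)) ∈ newtonPolygon m c :=
  subset_convexHull ℝ _ (Set.mem_biUnion hv ⟨le_rfl, le_rfl⟩)

theorem height_pos {h b : ℕ} (hh : h ≤ m) (hb : ((h : ℝ), (b : ℝ)) ∉ newtonPolygon m c) :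
    0 < height m c h b := by
  by_contra! hd
  refine hb (isLowerSet_newtonPolygon m c ?_ (isLeast_height m c h b hh).1)
  exact Prod.mk_le_mk.2 ⟨le_rfl, by linarith⟩

theorem exists_nonneg_supporting_functional {N : Set (ℝ × ℝ)} (hconvex : Convex ℝ N)
    (hlower : IsLowerSet N) {w z : ℝ × ℝ} (hw : w ∈ N) (hz : z ∉ interior N) :
    ∃ X Y : ℝ, 0 ≤ X ∧ 0 ≤ Y ∧ (X ≠ 0 ∨ Y ≠ 0)
      ∧ ∀ a ∈ N, a.1 * X + a.2 * Y ≤ z.1 * X + z.2 * Y := by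
  have hinterior : (w.1 - 1, w.2 - 1) ∈ interior N := by
    refine mem_interior.2 ⟨Set.Iio w.1 ×ˢ Set.Iio w.2, fun a ha => ?_, isOpen_Iio.prod isOpen_Iio,
      by simp⟩
    exact hlower (Prod.le_def.2 ⟨ha.1.le, ha.2.le⟩) hw
  obtain ⟨f, hf0, hf⟩ :=
    geometric_hahn_banach_of_nonempty_interior_point hconvex hz ⟨_, hinterior⟩
  have hf_nonneg (v : ℝ × ℝ) (hv : 0 ≤ v) : 0 ≤ f v := by
    by_contra! hfv
    obtain ⟨n, hn⟩ := exists_lt_nsmul (neg_pos.2 hfv) (f z - f w)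
    have hshift := hf (w - n • v) (hlower (sub_le_self w (nsmul_nonneg hv n)) hw)
    rw [map_sub, map_nsmul] at hshift
    rw [smul_neg] at hn
    linarith
  have hf_apply (a : ℝ × ℝ) : f a = a.1 * f (1, 0) + a.2 * f (0, 1) := by
    rw [← smul_eq_mul, ← smul_eq_mul, ← map_smul, ← map_smul, ← map_add]
    simp
  refine ⟨f (1, 0), f (0, 1), hf_nonneg _ (by simp [Prod.le_def]),
    hf_nonneg _ (by simp [Prod.le_def]), ?_, fun a ha => ?_⟩
  · by_contra! hzero
    exact hf0 (ContinuousLinearMap.ext fun a => by simp [hf_apply a, hzero])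
  · rw [← hf_apply, ← hf_apply]
    exact hf a ha

theorem sub_height_notMem_interior {h : ℕ} (hh : h ≤ m) (b : ℕ) :
    ((h : ℝ), (b : ℝ) - height m c h b) ∉ interior (newtonPolygon m c) := fun hmem => by
  have hcont : Continuous fun y : ℝ => ((h : ℝ), (b : ℝ) - y) := by fun_prop
  have hsub : (fun y : ℝ => ((h : ℝ), (b : ℝ) - y)) ⁻¹' newtonPolygon m c
      ⊆ Set.Ici (height m c h b) := (isLeast_height m c h b hh).2
  have hioi := interior_mono hsub (preimage_interior_subset_interior_preimage hcont hmem)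
  rw [interior_Ici] at hioi
  exact lt_irrefl _ (Set.mem_Ioi.1 hioi)

/-- The line through `(h, b - d)` is not vertical because `h < m`, and its slope `-κ` exceeds `-1`
because `(m, 0)` lies below it while `h + b ≤ m`. -/
theorem exists_slope_of_supporting_line {h b : ℕ} (hhb : (h, b) ∈ Im m)
    (hb : ((h : ℝ), (b : ℝ)) ∉ newtonPolygon m c) :
    ∃ κ : ℝ, 0 ≤ κ ∧ κ < 1 ∧ ∀ v ∈ Lam0 m c, κ * v.1 + v.2 ≤ κ * h + b - height m c h b := by
  obtain ⟨hhm, hhbm⟩ := mem_Im.1 hhb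
  have hd := height_pos hhm.le hb
  have hm0 : (m, 0) ∈ Lam0 m c := Or.inl rfl
  obtain ⟨X, Y, hX, hY, hXY, hline⟩ := exists_nonneg_supporting_functional
    (convex_convexHull ℝ _) (isLowerSet_newtonPolygon m c) (mem_newtonPolygon_of_mem_Lam0 hm0)
    (sub_height_notMem_interior hhm.le b)
  have hhm' : (h : ℝ) + 1 ≤ m := by exact_mod_cast hhm
  have hY_pos : 0 < Y := by
    refine hY.lt_of_ne' fun hY0 => ?_
    have hvertical := hline _ (mem_newtonPolygon_of_mem_Lam0 hm0)
    have hX_pos : 0 < X := hX.lt_of_ne' (hXY.resolve_right (not_not_intro hY0))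
    simp only [hY0, mul_zero, add_zero] at hvertical
    nlinarith
  have hκ (v : ℕ × ℕ) (hv : v ∈ Lam0 m c) :
      X / Y * v.1 + v.2 ≤ X / Y * h + b - height m c h b := by
    have hv := hline _ (mem_newtonPolygon_of_mem_Lam0 hv)
    field_simp
    linarith
  refine ⟨X / Y, by positivity, ?_, hκ⟩
  have hslope := hκ _ hm0
  have hhbm' : (h : ℝ) + b ≤ m := by exact_mod_cast hhbm
  simp only [Nat.cast_zero, add_zero] at hslope
  by_contra! hge
  nlinarith

theorem exists_rpow_mul_rpow_le_symbol (hc : ∀ v ∈ Im m, c v ≤ 0) :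
    ∃ K > 0, ∀ z ∈ newtonPolygon m c, ∀ k l : ℕ, 1 ≤ k → 1 ≤ l →
      (k : ℝ) ^ z.1 * (l : ℝ) ^ z.2 ≤ K * symbol m c k l := by
  obtain ⟨K, hK, hle⟩ := exists_pow_mul_pow_le_symbol hc
  refine ⟨K, hK, fun z hz k l hk hl => ?_⟩
  have hk0 : (0 : ℝ) < k := by exact_mod_cast hk
  have hl0 : (0 : ℝ) < l := by exact_mod_cast hl
  have hlog (x y : ℝ) :
      (k : ℝ) ^ x * (l : ℝ) ^ y = Real.exp (x * Real.log k + y * Real.log l) := by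
    rw [Real.rpow_def_of_pos hk0, Real.rpow_def_of_pos hl0, Real.exp_add, mul_comm x, mul_comm y]
  have hsymbol : 0 < K * symbol m c k l := mul_pos hK (symbol_pos hc hk l)
  rw [hlog, ← Real.le_log_iff_exp_le hsymbol]
  refine linear_le_of_mem_newtonPolygon (Real.log_natCast_nonneg k) (Real.log_natCast_nonneg l)
    (fun v hv => ?_) hz
  rw [Real.le_log_iff_exp_le hsymbol, ← hlog, Real.rpow_natCast, Real.rpow_natCast]
  exact hle v hv k l hk

theorem exists_pow_mul_pow_le_rpow_height_mul_symbol (hc : ∀ v ∈ Im m, c v ≤ 0) {h : ℕ}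
    (hh : h ≤ m) (b : ℕ) :
    ∃ K > 0, ∀ k l : ℕ, 1 ≤ k → 1 ≤ l →
      (k : ℝ) ^ h * (l : ℝ) ^ b ≤ K * (l : ℝ) ^ height m c h b * symbol m c k l := by
  obtain ⟨K, hK, hle⟩ := exists_rpow_mul_rpow_le_symbol hc
  refine ⟨K, hK, fun k l hk hl => ?_⟩
  have hl0 : (0 : ℝ) < l := by exact_mod_cast hl
  have hpoint := hle _ (isLeast_height m c h b hh).1 k l hk hl
  rw [Real.rpow_natCast, Real.rpow_sub hl0, Real.rpow_natCast, mul_div_assoc',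
    div_le_iff₀ (by positivity)] at hpoint
  linarith

end NewtonPolygon

/-! ### Recurrences for the coefficients -/

/-- The recurrence `P k l * a k l = f k l + b k (l - p) * a k (l - p)
+ e (k - q) (l - μ + α) * a (k - q) (l - μ + α)` satisfied by the coefficients of a formal solution
with vanishing initial value. The weights `b` and `e` are indexed by the position of the coefficient
they multiply, and a term is absent where a subtraction would truncate. -/
structure Recurrence (K : Type*) where
  (p q μ α : ℕ)
  p_pos : 0 < p
  q_pos : 0 < q
  (P f b e : ℕ → ℕ → K)

namespace Recurrence

section Field

variable {K : Type*} [Field K] (R : Recurrence K)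

/-- The term of the right-hand side that shifts `x`-exponents by `p`. -/
def xTerm (a : ℕ → ℕ → K) (k l : ℕ) : K :=
  if R.p ≤ l then R.b k (l - R.p) * a k (l - R.p) else 0

/-- The term of the right-hand side that shifts `t`-exponents by `q` and `x`-exponents by
`μ - α`. -/
def tTerm (a : ℕ → ℕ → K) (k l : ℕ) : K :=
  if R.q ≤ k ∧ R.μ ≤ l then
    R.e (k - R.q) (l - R.μ + R.α) * a (k - R.q) (l - R.μ + R.α) else 0

/-- The right-hand side of the recurrence. -/
def rhs (a : ℕ → ℕ → K) (k l : ℕ) : K := R.f k l + R.xTerm a k l + R.tTerm a k l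

/-- `a` satisfies the recurrence for `k ≥ 1` and vanishes for `k = 0`. -/
def IsSolution (a : ℕ → ℕ → K) : Prop :=
  (∀ l, a 0 l = 0) ∧ ∀ k l, 1 ≤ k → R.P k l * a k l = R.rhs a k l

variable {R}

omit [Field K] in
theorem induction (R : Recurrence K) {Q : ℕ → ℕ → Prop} (zero : ∀ l, Q 0 l)
    (step : ∀ k l, 1 ≤ k → (R.p ≤ l → Q k (l - R.p)) →
      (R.q ≤ k → R.μ ≤ l → Q (k - R.q) (l - R.μ + R.α)) → Q k l) (k l : ℕ) : Q k l := by
  induction k using Nat.strong_induction_on generalizing l with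
  | _ k ihk =>
    rcases Nat.eq_zero_or_pos k with rfl | hk
    · exact zero l
    induction l using Nat.strong_induction_on with
    | _ l ihl =>
      have hp := R.p_pos
      have hq := R.q_pos
      exact step k l hk (fun _ => ihl _ (by omega)) fun _ _ => ihk _ (by omega) _

theorem xTerm_add (a : ℕ → ℕ → K) (k l : ℕ) : R.xTerm a k (l + R.p) = R.b k l * a k l := by
  simp [xTerm]

theorem tTerm_add (a : ℕ → ℕ → K) (k l : ℕ) :
    R.tTerm a (k + R.q) (l + R.μ) = R.e k (l + R.α) * a k (l + R.α) := by
  simp [tTerm]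

theorem rhs_zero_left {a : ℕ → ℕ → K} (ha : ∀ l, a 0 l = 0) (l : ℕ) : R.rhs a 0 l = R.f 0 l := by
  simp [rhs, xTerm, tTerm, ha, R.q_pos.ne']

theorem rhs_congr {a a' : ℕ → ℕ → K} {k l : ℕ}
    (hx : R.p ≤ l → a k (l - R.p) = a' k (l - R.p))
    (ht : R.q ≤ k → R.μ ≤ l → a (k - R.q) (l - R.μ + R.α) = a' (k - R.q) (l - R.μ + R.α)) :
    R.rhs a k l = R.rhs a' k l := by
  have hxTerm : R.xTerm a k l = R.xTerm a' k l :=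
    ite_congr rfl (fun hl => congrArg _ (hx hl)) fun _ => rfl
  have htTerm : R.tTerm a k l = R.tTerm a' k l :=
    ite_congr rfl (fun hkl => congrArg _ (ht hkl.1 hkl.2)) fun _ => rfl
  rw [rhs, hxTerm, htTerm, rhs]

theorem IsSolution.unique {a a' : ℕ → ℕ → K} (hP : ∀ k l, 1 ≤ k → R.P k l ≠ 0)
    (ha : R.IsSolution a) (ha' : R.IsSolution a') : a = a' := by
  funext k l
  induction k, l using R.induction with
  | zero l => rw [ha.1, ha'.1]
  | step k l hk hx ht =>
    refine mul_left_cancel₀ (hP k l hk) ?_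
    rw [ha.2 k l hk, ha'.2 k l hk, rhs_congr hx ht]

variable (R) in
/-- The solution of the recurrence when `P k l ≠ 0` for all `k ≥ 1`. -/
def solution : ℕ → ℕ → K
  | 0, _ => 0
  | k + 1, l =>
    (R.f (k + 1) l
      + (if _hl : R.p ≤ l then R.b (k + 1) (l - R.p) * solution (k + 1) (l - R.p) else 0)
      + if _hkl : R.q ≤ k + 1 ∧ R.μ ≤ l then
          R.e (k + 1 - R.q) (l - R.μ + R.α) * solution (k + 1 - R.q) (l - R.μ + R.α) else 0)
      / R.P (k + 1) l
termination_by k l => (k, l)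
decreasing_by
  · have := R.p_pos
    exact Prod.Lex.right _ (by omega)
  · have := R.q_pos
    exact Prod.Lex.left _ _ (by omega)

theorem isSolution_solution (hP : ∀ k l, 1 ≤ k → R.P k l ≠ 0) : R.IsSolution R.solution := by
  refine ⟨fun l => by rw [solution], fun k l hk => ?_⟩
  obtain ⟨k, rfl⟩ := Nat.exists_eq_add_of_le' hk
  conv_lhs => rw [solution]
  rw [mul_div_cancel₀ _ (hP _ l hk)]
  simp only [dite_eq_ite, rhs, xTerm, tTerm]

variable (R) in
/-- The recurrence over `L` obtained by applying `ψ : K →+* L` to all weights. -/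
def map {L : Type*} [Field L] (ψ : K →+* L) : Recurrence L where
  __ := R
  P k l := ψ (R.P k l)
  f k l := ψ (R.f k l)
  b k l := ψ (R.b k l)
  e k l := ψ (R.e k l)

theorem IsSolution.map {L : Type*} [Field L] (ψ : K →+* L) {a : ℕ → ℕ → K}
    (ha : R.IsSolution a) : (R.map ψ).IsSolution fun k l => ψ (a k l) := by
  refine ⟨fun l => (congrArg ψ (ha.1 l)).trans (map_zero ψ), fun k l hk => ?_⟩
  have heq := congrArg ψ (ha.2 k l hk)
  simp only [rhs, xTerm, tTerm, map_add, map_mul, apply_ite ψ, map_zero] at heq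
  exact heq

end Field

section Order

variable {K : Type*} [Field K] [LinearOrder K] {R : Recurrence K}

/-- Positivity of the weights, which makes the recurrence monotone. -/
structure IsPositive (R : Recurrence K) : Prop where
  P_pos : ∀ k l, 1 ≤ k → 0 < R.P k l
  f_nonneg : ∀ k l, 0 ≤ R.f k l
  b_nonneg : ∀ k l, 0 ≤ R.b k l
  e_nonneg : ∀ k l, 0 ≤ R.e k l

variable [IsStrictOrderedRing K]

namespace IsPositive

variable (hR : R.IsPositive)

include hR

theorem xTerm_mono {a w : ℕ → ℕ → K} {k l : ℕ} (h : R.p ≤ l → a k (l - R.p) ≤ w k (l - R.p)) :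
    R.xTerm a k l ≤ R.xTerm w k l := by
  unfold xTerm
  split_ifs with hl
  exacts [mul_le_mul_of_nonneg_left (h hl) (hR.b_nonneg _ _), le_rfl]

theorem tTerm_mono {a w : ℕ → ℕ → K} {k l : ℕ}
    (h : R.q ≤ k → R.μ ≤ l → a (k - R.q) (l - R.μ + R.α) ≤ w (k - R.q) (l - R.μ + R.α)) :
    R.tTerm a k l ≤ R.tTerm w k l := by
  unfold tTerm
  split_ifs with hkl
  exacts [mul_le_mul_of_nonneg_left (h hkl.1 hkl.2) (hR.e_nonneg _ _), le_rfl]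

theorem xTerm_nonneg {a : ℕ → ℕ → K} (ha : ∀ k l, 0 ≤ a k l) (k l : ℕ) : 0 ≤ R.xTerm a k l :=
  le_of_eq_of_le (by simp [xTerm]) (hR.xTerm_mono (a := 0) fun _ => ha _ _)

theorem tTerm_nonneg {a : ℕ → ℕ → K} (ha : ∀ k l, 0 ≤ a k l) (k l : ℕ) : 0 ≤ R.tTerm a k l :=
  le_of_eq_of_le (by simp [tTerm]) (hR.tTerm_mono (a := 0) fun _ _ => ha _ _)

theorem le_of_subsolution_of_supersolution {a w : ℕ → ℕ → K}
    (h0 : ∀ l, a 0 l ≤ w 0 l) (ha : ∀ k l, 1 ≤ k → R.P k l * a k l ≤ R.rhs a k l)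
    (hw : ∀ k l, 1 ≤ k → R.rhs w k l ≤ R.P k l * w k l) (k l : ℕ) : a k l ≤ w k l := by
  induction k, l using R.induction with
  | zero l => exact h0 l
  | step k l hk hx ht =>
    refine le_of_mul_le_mul_left ((ha k l hk).trans (le_trans ?_ (hw k l hk))) (hR.P_pos k l hk)
    exact add_le_add_three le_rfl (hR.xTerm_mono hx) (hR.tTerm_mono ht)

theorem xTerm_geometric_mul_le {w : ℕ → ℕ → K} (hw : ∀ k l, 0 ≤ w k l) {M K₁ τ σ : K}
    (hM : 0 ≤ M) (hτ : 0 ≤ τ) (hσ : 0 ≤ σ) (hσK : 3 * K₁ ≤ σ ^ R.p)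
    (hb : ∀ k l, 1 ≤ k → R.b k l * w k l ≤ K₁ * (R.P k (l + R.p) * w k (l + R.p)))
    {k : ℕ} (hk : 1 ≤ k) (l : ℕ) :
    R.xTerm (fun k l => 3 * M * (τ ^ k * σ ^ l) * w k l) k l
      ≤ M * (τ ^ k * σ ^ l) * (R.P k l * w k l) := by
  have hPw (l : ℕ) : 0 ≤ R.P k l * w k l := mul_nonneg (hR.P_pos k l hk).le (hw k l)
  rcases lt_or_ge l R.p with hl | hl
  · rw [xTerm, if_neg hl.not_ge]
    have hPw := hPw l
    positivity
  obtain ⟨l, rfl⟩ := Nat.exists_eq_add_of_le' hl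
  have hPw := hPw (l + R.p)
  calc _ = 3 * M * (τ ^ k * σ ^ l) * (R.b k l * w k l) := by rw [xTerm_add]; ring
    _ ≤ 3 * M * (τ ^ k * σ ^ l) * (K₁ * (R.P k (l + R.p) * w k (l + R.p))) :=
      mul_le_mul_of_nonneg_left (hb k l hk) (by positivity)
    _ = M * (τ ^ k * σ ^ l) * (3 * K₁) * (R.P k (l + R.p) * w k (l + R.p)) := by ring
    _ ≤ M * (τ ^ k * σ ^ l) * σ ^ R.p * (R.P k (l + R.p) * w k (l + R.p)) := by gcongr
    _ = M * (τ ^ k * σ ^ (l + R.p)) * (R.P k (l + R.p) * w k (l + R.p)) := by ring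

theorem tTerm_geometric_mul_le {w : ℕ → ℕ → K} (hw : ∀ k l, 0 ≤ w k l) {M K₂ τ σ : K}
    (hM : 0 ≤ M) (hτ : 0 ≤ τ) (hσ : 1 ≤ σ) (hτK : 3 * K₂ * σ ^ R.α ≤ τ ^ R.q)
    (he : ∀ k l, R.e k (l + R.α) * w k (l + R.α)
      ≤ K₂ * (R.P (k + R.q) (l + R.μ) * w (k + R.q) (l + R.μ)))
    {k : ℕ} (hk : 1 ≤ k) (l : ℕ) :
    R.tTerm (fun k l => 3 * M * (τ ^ k * σ ^ l) * w k l) k l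
      ≤ M * (τ ^ k * σ ^ l) * (R.P k l * w k l) := by
  have hPw : 0 ≤ R.P k l * w k l := mul_nonneg (hR.P_pos k l hk).le (hw k l)
  by_cases hkl : ¬(R.q ≤ k ∧ R.μ ≤ l)
  · rw [tTerm, if_neg hkl]
    positivity
  obtain ⟨hqk, hμl⟩ := not_not.1 hkl
  obtain ⟨k, rfl⟩ := Nat.exists_eq_add_of_le' hqk
  obtain ⟨l, rfl⟩ := Nat.exists_eq_add_of_le' hμl
  set V := R.P (k + R.q) (l + R.μ) * w (k + R.q) (l + R.μ)
  calc _ = 3 * M * (τ ^ k * σ ^ (l + R.α)) * (R.e k (l + R.α) * w k (l + R.α)) := by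
        rw [tTerm_add]; ring
    _ ≤ 3 * M * (τ ^ k * σ ^ (l + R.α)) * (K₂ * V) :=
        mul_le_mul_of_nonneg_left (he k l) (by positivity)
    _ = M * (τ ^ k * σ ^ l) * (3 * K₂ * σ ^ R.α) * V := by ring
    _ ≤ M * (τ ^ k * σ ^ l) * τ ^ R.q * V := by gcongr
    _ = M * (τ ^ (k + R.q) * σ ^ l) * V := by ring
    _ ≤ M * (τ ^ (k + R.q) * σ ^ (l + R.μ)) * V := by
        gcongr
        exact Nat.le_add_right _ _

end IsPositive

namespace IsSolution

variable {a : ℕ → ℕ → K} (ha : R.IsSolution a) (hR : R.IsPositive)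

include ha hR

theorem nonneg (k l : ℕ) : 0 ≤ a k l := by
  refine hR.le_of_subsolution_of_supersolution (a := fun _ _ => 0) (fun l => (ha.1 l).ge)
    (fun k l _ => ?_) (fun k l hk => (ha.2 k l hk).ge) k l
  simpa [rhs, xTerm, tTerm] using hR.f_nonneg k l

theorem source_le {k : ℕ} (hk : 1 ≤ k) (l : ℕ) : R.f k l ≤ R.P k l * a k l := by
  rw [ha.2 k l hk, rhs, add_assoc]
  exact le_add_of_nonneg_right <| add_nonneg (hR.xTerm_nonneg (ha.nonneg hR) k l)
    (hR.tTerm_nonneg (ha.nonneg hR) k l)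

theorem mul_le_x_shift {k : ℕ} (hk : 1 ≤ k) (l : ℕ) :
    R.b k l * a k l ≤ R.P k (l + R.p) * a k (l + R.p) := by
  rw [ha.2 k _ hk, ← xTerm_add]
  exact le_add_of_le_of_nonneg (le_add_of_nonneg_left (hR.f_nonneg _ _))
    (hR.tTerm_nonneg (ha.nonneg hR) _ _)

theorem mul_le_t_shift (k l : ℕ) :
    R.e k (l + R.α) * a k (l + R.α) ≤ R.P (k + R.q) (l + R.μ) * a (k + R.q) (l + R.μ) := by
  rw [ha.2 _ _ (R.q_pos.trans_le (Nat.le_add_left _ _)), ← tTerm_add]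
  exact le_add_of_nonneg_left <| add_nonneg (hR.f_nonneg _ _)
    (hR.xTerm_nonneg (ha.nonneg hR) _ _)

theorem prod_mul_le_x_shift {k l N : ℕ} (hk : 1 ≤ k) {Y : K} (hY0 : 0 ≤ Y)
    (hY : ∀ l' ≤ l + R.p * N, R.P k l' ≤ Y) :
    (∏ i ∈ Finset.range N, R.b k (l + R.p * i)) * a k l ≤ Y ^ N * a k (l + R.p * N) := by
  induction N with
  | zero => simp
  | succ N ih =>
    have ihN := ih fun l' hl' => hY l' (hl'.trans (by gcongr; exact N.le_succ))
    have hstep := ha.mul_le_x_shift hR hk (l + R.p * N)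
    rw [add_assoc, ← Nat.mul_succ] at hstep
    calc (∏ i ∈ Finset.range (N + 1), R.b k (l + R.p * i)) * a k l
        = R.b k (l + R.p * N) * ((∏ i ∈ Finset.range N, R.b k (l + R.p * i)) * a k l) := by
          rw [Finset.prod_range_succ]
          ring
      _ ≤ R.b k (l + R.p * N) * (Y ^ N * a k (l + R.p * N)) :=
          mul_le_mul_of_nonneg_left ihN (hR.b_nonneg _ _)
      _ = Y ^ N * (R.b k (l + R.p * N) * a k (l + R.p * N)) := by ring
      _ ≤ Y ^ N * (Y * a k (l + R.p * (N + 1))) :=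
          mul_le_mul_of_nonneg_left (hstep.trans (mul_le_mul_of_nonneg_right (hY _ le_rfl)
            (ha.nonneg hR _ _))) (pow_nonneg hY0 N)
      _ = Y ^ (N + 1) * a k (l + R.p * (N + 1)) := by ring

theorem prod_mul_le_t_shift {δ : ℕ} (hα : R.α = R.μ + δ) {k l N : ℕ} (hl : R.μ ≤ l) {Y : K}
    (hY0 : 0 ≤ Y) (hY : ∀ k' ≤ k + R.q * N, ∀ l' ≤ l + δ * N, R.P k' l' ≤ Y) :
    (∏ i ∈ Finset.range N, R.e (k + R.q * i) (l + δ * (N - i))) * a k (l + δ * N)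
      ≤ Y ^ N * a (k + R.q * N) l := by
  induction N generalizing l with
  | zero => simp
  | succ N ih =>
    have ihN := ih (hl.trans (l.le_add_right δ)) fun k' hk' l' hl' =>
      hY k' (hk'.trans (by gcongr; exact N.le_succ)) l' (hl'.trans_eq (by ring))
    have hstep := ha.mul_le_t_shift hR (k + R.q * N) (l - R.μ)
    rw [hα, ← add_assoc, Nat.sub_add_cancel hl, add_assoc k, ← Nat.mul_succ] at hstep
    have hprod : ∏ i ∈ Finset.range N, R.e (k + R.q * i) (l + δ * (N + 1 - i))
        = ∏ i ∈ Finset.range N, R.e (k + R.q * i) (l + δ + δ * (N - i)) := by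
      refine Finset.prod_congr rfl fun i hi => ?_
      rw [Nat.succ_sub (Finset.mem_range.1 hi).le, Nat.mul_succ, add_comm (δ * _), add_assoc]
    rw [Finset.prod_range_succ, hprod, Nat.add_sub_cancel_left, mul_one]
    set E := R.e (k + R.q * N) (l + δ)
    calc _ = E * ((∏ i ∈ Finset.range N, R.e (k + R.q * i) (l + δ + δ * (N - i)))
          * a k (l + δ + δ * N)) := by ring_nf
      _ ≤ E * (Y ^ N * a (k + R.q * N) (l + δ)) :=
          mul_le_mul_of_nonneg_left ihN (hR.e_nonneg _ _)
      _ = Y ^ N * (E * a (k + R.q * N) (l + δ)) := by ring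
      _ ≤ Y ^ N * (Y * a (k + R.q * (N + 1)) l) :=
          mul_le_mul_of_nonneg_left (hstep.trans (mul_le_mul_of_nonneg_right
            (hY _ le_rfl _ (l.le_add_right _)) (ha.nonneg hR _ _))) (pow_nonneg hY0 N)
      _ = Y ^ (N + 1) * a (k + R.q * (N + 1)) l := by ring

theorem exists_le_geometric_mul {w : ℕ → ℕ → K} (hw : ∀ k l, 0 ≤ w k l) {M₀ K₁ K₂ : K}
    (hM₀ : 0 < M₀) (hK₁ : 0 ≤ K₁) (hK₂ : 0 ≤ K₂)
    (hf : ∀ k l, 1 ≤ k → R.f k l ≤ M₀ * (R.P k l * w k l))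
    (hb : ∀ k l, 1 ≤ k → R.b k l * w k l ≤ K₁ * (R.P k (l + R.p) * w k (l + R.p)))
    (he : ∀ k l, R.e k (l + R.α) * w k (l + R.α)
      ≤ K₂ * (R.P (k + R.q) (l + R.μ) * w (k + R.q) (l + R.μ))) :
    ∃ M > 0, ∃ ρ ≥ 1, ∀ k l, a k l ≤ M * ρ ^ (k + l) * w k l := by
  set σ : K := 1 + 3 * K₁
  set τ : K := 1 + 3 * K₂ * σ ^ R.α
  have hσ : 1 ≤ σ := le_add_of_nonneg_right (by positivity)
  have hσ0 : 0 < σ := one_pos.trans_le hσ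
  have hτ : 1 ≤ τ := le_add_of_nonneg_right (by positivity)
  have hτ0 : 0 < τ := one_pos.trans_le hτ
  have hσp : 3 * K₁ ≤ σ ^ R.p :=
    (le_add_of_nonneg_left zero_le_one).trans (le_self_pow₀ hσ R.p_pos.ne')
  have hτq : 3 * K₂ * σ ^ R.α ≤ τ ^ R.q :=
    (le_add_of_nonneg_left zero_le_one).trans (le_self_pow₀ hτ R.q_pos.ne')
  have h0 (l : ℕ) : a 0 l ≤ 3 * M₀ * (τ ^ 0 * σ ^ l) * w 0 l := by
    have hw0 := hw 0 l
    rw [ha.1]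
    positivity
  refine ⟨3 * M₀, by positivity, τ * σ, one_le_mul_of_one_le_of_one_le hτ hσ, fun k l => ?_⟩
  have hsource (k l : ℕ) (hk : 1 ≤ k) : R.f k l ≤ M₀ * (τ ^ k * σ ^ l) * (R.P k l * w k l) := by
    refine (hf k l hk).trans (mul_le_mul_of_nonneg_right (le_mul_of_one_le_right hM₀.le ?_) ?_)
    · exact one_le_mul_of_one_le_of_one_le (one_le_pow₀ hτ) (one_le_pow₀ hσ)
    · exact mul_nonneg (hR.P_pos k l hk).le (hw k l)
  calc a k l ≤ 3 * M₀ * (τ ^ k * σ ^ l) * w k l := by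
        refine hR.le_of_subsolution_of_supersolution h0 (fun k l hk => (ha.2 k l hk).le)
          (w := fun k l => 3 * M₀ * (τ ^ k * σ ^ l) * w k l) (fun k l hk => ?_) k l
        refine (add_le_add_three (hsource k l hk)
          (hR.xTerm_geometric_mul_le hw hM₀.le hτ0.le hσ0.le hσp hb hk l)
          (hR.tTerm_geometric_mul_le hw hM₀.le hτ0.le hσ hτq he hk l)).trans_eq ?_
        ring
    _ ≤ 3 * M₀ * (τ * σ) ^ (k + l) * w k l := by
        have hwkl := hw k l
        rw [mul_pow]
        gcongr <;> omega

end IsSolution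

end Order

end Recurrence

theorem isFormalSolution_iff {m : ℕ} {c : ℕ × ℕ → ℝ} {rhs : Series → Series} {R : Recurrence ℂ}
    (hP : ∀ k l, R.P k l = symbol m c k l) (hf : ∀ l, R.f 0 l = 0)
    (hrhs : ∀ u k l, cf (rhs u) k l = R.rhs (cf u) k l) {u : Series} :
    IsFormalSolution m c rhs u ↔ R.IsSolution (cf u) := by
  refine and_congr_right fun h0 => ⟨fun hu k l _ => ?_, fun hu => series_ext fun k l => ?_⟩
  · rw [hP, ← cf_opL, hu, hrhs]
  · rw [cf_opL, hrhs, ← hP]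
    rcases Nat.eq_zero_or_pos k with rfl | hk
    · rw [h0, mul_zero, Recurrence.rhs_zero_left h0, hf]
    · exact hu k l hk

/-! ### The majorant -/

theorem factorial_add_le_pow_mul (n i : ℕ) : (n + i)! ≤ (n + i) ^ i * n ! := by
  rw [← Nat.factorial_mul_descFactorial (Nat.le_add_left i n), Nat.add_sub_cancel, mul_comm]
  exact Nat.mul_le_mul_right _ (Nat.descFactorial_le_pow _ _)

theorem add_pow_mul_factorial_le (n i : ℕ) : (n + i) ^ i * n ! ≤ i ^ i * (n + i)! := by
  rw [← Nat.factorial_mul_descFactorial (Nat.le_add_left i n), Nat.add_sub_cancel, mul_left_comm,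
    mul_comm]
  exact Nat.mul_le_mul_left _ (pow_le_mul_descFactorial (Nat.le_add_left i n))

theorem pow_mul_ascFactorial_le {l δ n : ℕ} (h : δ ≤ n) (x : ℕ) :
    (l + 1) ^ n * (l + δ + 1).ascFactorial x ≤ (l + 1).ascFactorial (x + n) := by
  have hsplit : (l + 1).ascFactorial (x + n) = (l + 1).ascFactorial δ
      * (l + δ + 1).ascFactorial x * (l + δ + 1 + x).ascFactorial (n - δ) := by
    rw [show l + δ + 1 = l + 1 + δ by ring, Nat.ascFactorial_mul_ascFactorial,
      show l + 1 + δ + x = l + 1 + (δ + x) by ring, Nat.ascFactorial_mul_ascFactorial]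
    congr 1
    omega
  have hfirst : (l + 1) ^ δ ≤ (l + 1).ascFactorial δ := Nat.pow_succ_le_ascFactorial _ _
  have hlast : (l + 1) ^ (n - δ) ≤ (l + δ + 1 + x).ascFactorial (n - δ) :=
    (Nat.pow_le_pow_left (by omega) _).trans (Nat.pow_succ_le_ascFactorial _ _)
  calc (l + 1) ^ n * (l + δ + 1).ascFactorial x
      = (l + 1) ^ δ * (l + δ + 1).ascFactorial x * (l + 1) ^ (n - δ) := by
        rw [mul_right_comm, ← pow_add, Nat.add_sub_cancel' h]
    _ ≤ (l + 1).ascFactorial (x + n) := by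
        rw [hsplit]
        gcongr

theorem exists_factorial_mul_le (a : ℕ) :
    ∃ c : ℕ, 1 ≤ c ∧ ∀ k : ℕ, (a * k)! ≤ c ^ k * k ! ^ a := by
  induction a with
  | zero => exact ⟨1, le_rfl, fun k => by simp⟩
  | succ a ih =>
    obtain ⟨c, hc, hle⟩ := ih
    refine ⟨2 ^ (a + 1) * c, one_le_mul Nat.one_le_two_pow hc, fun k => ?_⟩
    calc ((a + 1) * k)! = (a * k + k).choose k * (a * k)! * k ! := by
          rw [Nat.add_choose_mul_factorial_mul_factorial, Nat.succ_mul]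
      _ ≤ (2 ^ (a + 1)) ^ k * (c ^ k * k ! ^ a) * k ! := by
          gcongr
          · rw [← pow_mul, Nat.succ_mul]
            exact Nat.choose_le_two_pow _ _
          · exact hle k
      _ = (2 ^ (a + 1) * c) ^ k * k ! ^ (a + 1) := by rw [mul_pow, pow_succ (k !)]; ring

theorem exists_ascFactorial_mul_le (a : ℕ) :
    ∃ c : ℕ, 1 ≤ c ∧ ∀ k l : ℕ, (l + 1).ascFactorial (a * k) ≤ c ^ (k + l) * k ! ^ a := by
  obtain ⟨c, hc, hle⟩ := exists_factorial_mul_le a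
  refine ⟨c * 2 ^ (a + 1), one_le_mul hc Nat.one_le_two_pow, fun k l => ?_⟩
  have hchoose : (l + a * k).choose (a * k) ≤ (2 ^ (a + 1)) ^ (k + l) := by
    refine (Nat.choose_le_two_pow _ _).trans ?_
    rw [← pow_mul]
    exact Nat.pow_le_pow_right two_pos (by nlinarith [Nat.zero_le (a * l)])
  calc (l + 1).ascFactorial (a * k) = (a * k)! * (l + a * k).choose (a * k) :=
        Nat.ascFactorial_eq_factorial_mul_choose _ _
    _ ≤ c ^ k * k ! ^ a * (2 ^ (a + 1)) ^ (k + l) := Nat.mul_le_mul (hle k) hchoose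
    _ ≤ c ^ (k + l) * k ! ^ a * (2 ^ (a + 1)) ^ (k + l) := by
        gcongr
        exact Nat.le_add_right k l
    _ = (c * 2 ^ (a + 1)) ^ (k + l) * k ! ^ a := by rw [mul_pow]; ring

/-- The majorant of the coefficients of the solution. It grows like `k!^(α τ - ν) l!^e`; the rising
factorial `(l + 1) ⋯ (l + α k)` takes the place of `k!^α` because it absorbs a shift `l ↦ l + δ`
when `k` increases. -/
def gevreyWeight (α : ℕ) (ν τ e : ℝ) (k l : ℕ) : ℝ :=
  (k ! : ℝ) ^ (-ν) * ((l + 1).ascFactorial (α * k) : ℝ) ^ τ * (l ! : ℝ) ^ e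

section GevreyWeight

variable {ν τ e : ℝ}

theorem gevreyWeight_pos (α : ℕ) (ν τ e : ℝ) (k l : ℕ) : 0 < gevreyWeight α ν τ e k l := by
  unfold gevreyWeight
  positivity

theorem gevreyWeight_x_shift (hτ : 0 ≤ τ) (he : 0 ≤ e) (α : ℕ) (ν : ℝ) (k l p : ℕ) :
    ((l + p : ℕ) : ℝ) ^ (p * e) * gevreyWeight α ν τ e k l
      ≤ ((p : ℝ) ^ p) ^ e * gevreyWeight α ν τ e k (l + p) := by
  have hfactorial : ((l + p : ℕ) : ℝ) ^ (p * e) * (l ! : ℝ) ^ e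
      ≤ ((p : ℝ) ^ p) ^ e * ((l + p)! : ℝ) ^ e := by
    rw [Real.rpow_natCast_mul (by positivity), ← Real.mul_rpow (by positivity) (by positivity),
      ← Real.mul_rpow (by positivity) (by positivity)]
    refine Real.rpow_le_rpow (by positivity) ?_ he
    exact_mod_cast add_pow_mul_factorial_le l p
  calc ((l + p : ℕ) : ℝ) ^ (p * e) * gevreyWeight α ν τ e k l
      = (k ! : ℝ) ^ (-ν) * ((l + 1).ascFactorial (α * k) : ℝ) ^ τ
        * (((l + p : ℕ) : ℝ) ^ (p * e) * (l ! : ℝ) ^ e) := by rw [gevreyWeight]; ring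
    _ ≤ (k ! : ℝ) ^ (-ν) * ((l + p + 1).ascFactorial (α * k) : ℝ) ^ τ
        * (((p : ℝ) ^ p) ^ e * ((l + p)! : ℝ) ^ e) := by
        gcongr
        exact Nat.le_add_right l p
    _ = ((p : ℝ) ^ p) ^ e * gevreyWeight α ν τ e k (l + p) := by rw [gevreyWeight]; ring

theorem rpow_neg_factorial_le (hν : 0 ≤ ν) (k q : ℕ) :
    (k ! : ℝ) ^ (-ν) ≤ ((k + q : ℕ) : ℝ) ^ (q * ν) * ((k + q)! : ℝ) ^ (-ν) := by
  rw [Real.rpow_neg (by positivity), Real.rpow_neg (by positivity), ← div_eq_mul_inv,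
    inv_le_iff_one_le_mul₀ (by positivity), div_mul_eq_mul_div, one_le_div (by positivity),
    Real.rpow_natCast_mul (by positivity), ← Real.mul_rpow (by positivity) (by positivity)]
  refine Real.rpow_le_rpow (by positivity) ?_ hν
  exact_mod_cast factorial_add_le_pow_mul k q

theorem rpow_factorial_add_le (he : 0 ≤ e) (l δ : ℕ) :
    ((l + δ)! : ℝ) ^ e ≤ ((δ : ℝ) + 1) ^ (δ * e) * ((l : ℝ) + 1) ^ (δ * e) * (l ! : ℝ) ^ e := by
  rw [← Real.mul_rpow (by positivity) (by positivity), Real.rpow_natCast_mul (by positivity),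
    ← Real.mul_rpow (by positivity) (by positivity)]
  refine Real.rpow_le_rpow (by positivity) ?_ he
  have hle : (l + δ)! ≤ ((δ + 1) * (l + 1)) ^ δ * l ! :=
    (factorial_add_le_pow_mul l δ).trans (by gcongr; nlinarith)
  exact_mod_cast hle

theorem gevreyWeight_t_shift (hν : 0 ≤ ν) (hτ : 0 ≤ τ) (he : 0 ≤ e) {α q δ : ℕ} (hδ : δ ≤ α * q)
    (k l : ℕ) :
    ((l : ℝ) + 1) ^ (α * q * τ - δ * e) * gevreyWeight α ν τ e k (l + δ)
      ≤ ((δ : ℝ) + 1) ^ (δ * e) * (((k + q : ℕ) : ℝ) ^ (q * ν)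
        * gevreyWeight α ν τ e (k + q) l) := by
  have hasc : ((l : ℝ) + 1) ^ (α * q * τ) * ((l + δ + 1).ascFactorial (α * k) : ℝ) ^ τ
      ≤ ((l + 1).ascFactorial (α * (k + q)) : ℝ) ^ τ := by
    rw [← Nat.cast_mul, Real.rpow_natCast_mul (by positivity),
      ← Real.mul_rpow (by positivity) (by positivity)]
    refine Real.rpow_le_rpow (by positivity) ?_ hτ
    rw [mul_add]
    exact_mod_cast pow_mul_ascFactorial_le hδ (α * k)
  calc ((l : ℝ) + 1) ^ (α * q * τ - δ * e) * gevreyWeight α ν τ e k (l + δ)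
      ≤ ((l : ℝ) + 1) ^ (α * q * τ - δ * e)
        * ((((k + q : ℕ) : ℝ) ^ (q * ν) * ((k + q)! : ℝ) ^ (-ν))
          * ((l + δ + 1).ascFactorial (α * k) : ℝ) ^ τ
          * (((δ : ℝ) + 1) ^ (δ * e) * ((l : ℝ) + 1) ^ (δ * e) * (l ! : ℝ) ^ e)) := by
        rw [gevreyWeight]
        gcongr
        exacts [rpow_neg_factorial_le hν k q, rpow_factorial_add_le he l δ]
    _ = ((δ : ℝ) + 1) ^ (δ * e) * (((k + q : ℕ) : ℝ) ^ (q * ν) * (((k + q)! : ℝ) ^ (-ν)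
        * (((l : ℝ) + 1) ^ (α * q * τ) * ((l + δ + 1).ascFactorial (α * k) : ℝ) ^ τ)
        * (l ! : ℝ) ^ e)) := by
        rw [← sub_add_cancel (α * q * τ) (δ * e), Real.rpow_add (by positivity),
          add_sub_cancel_right]
        ring
    _ ≤ ((δ : ℝ) + 1) ^ (δ * e) * (((k + q : ℕ) : ℝ) ^ (q * ν)
        * gevreyWeight α ν τ e (k + q) l) := by
        rw [gevreyWeight]
        gcongr

theorem exists_gevreyWeight_le (hτ : 0 ≤ τ) (α : ℕ) (ν e : ℝ) : ∃ c : ℝ, 1 ≤ c ∧ ∀ k l : ℕ,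
    gevreyWeight α ν τ e k l ≤ c ^ (k + l) * ((k ! : ℝ) ^ (α * τ - ν) * (l ! : ℝ) ^ e) := by
  obtain ⟨c, hc, hle⟩ := exists_ascFactorial_mul_le α
  refine ⟨(c : ℝ) ^ τ, Real.one_le_rpow (by exact_mod_cast hc) hτ, fun k l => ?_⟩
  have hasc : ((l + 1).ascFactorial (α * k) : ℝ) ^ τ
      ≤ ((c : ℝ) ^ τ) ^ (k + l) * (k ! : ℝ) ^ (α * τ) := by
    rw [Real.rpow_pow_comm (by positivity), Real.rpow_natCast_mul (by positivity),
      ← Real.mul_rpow (by positivity) (by positivity)]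
    exact Real.rpow_le_rpow (by positivity) (by exact_mod_cast hle k l) hτ
  calc gevreyWeight α ν τ e k l
      ≤ (k ! : ℝ) ^ (-ν) * (((c : ℝ) ^ τ) ^ (k + l) * (k ! : ℝ) ^ (α * τ)) * (l ! : ℝ) ^ e := by
        rw [gevreyWeight]
        gcongr
    _ = ((c : ℝ) ^ τ) ^ (k + l) * ((k ! : ℝ) ^ (α * τ - ν) * (l ! : ℝ) ^ e) := by
        rw [sub_eq_add_neg, Real.rpow_add (by positivity)]
        ring

end GevreyWeight

/-! ### Orders of growth -/

/-- The sequence `x` grows at least like `r!^θ`, up to a geometric factor. -/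
def GrowsAtLeast (θ : ℝ) (x : ℕ → ℝ) : Prop :=
  ∃ C : ℝ, ∀ᶠ r : ℕ in atTop, Real.exp (r * (θ * Real.log r - C)) ≤ x r

/-- The sequence `x` grows at most like `r!^θ`, up to a geometric factor. -/
def GrowsAtMost (θ : ℝ) (x : ℕ → ℝ) : Prop :=
  ∃ C : ℝ, ∀ᶠ r : ℕ in atTop, x r ≤ Real.exp (r * (θ * Real.log r + C))

theorem GrowsAtLeast.le {θ θ' : ℝ} {x : ℕ → ℝ} (h : GrowsAtLeast θ x) (h' : GrowsAtMost θ' x) :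
    θ ≤ θ' := by
  obtain ⟨C, hC⟩ := h
  obtain ⟨C', hC'⟩ := h'
  by_contra! hlt
  have hlog : Tendsto (fun r : ℕ => (θ - θ') * Real.log r) atTop atTop :=
    (Real.tendsto_log_atTop.comp tendsto_natCast_atTop_atTop).const_mul_atTop (sub_pos.2 hlt)
  obtain ⟨r, hle, hle', hr, hgt⟩ := (hC.and (hC'.and ((eventually_gt_atTop 0).and
    (hlog.eventually_gt_atTop (C + C'))))).exists
  have hexp := le_of_mul_le_mul_left (Real.exp_le_exp.1 (hle.trans hle')) (Nat.cast_pos.2 hr)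
  linarith

section FloorRpow

variable {κ : ℝ} (hκ : κ < 1) {r : ℕ} (hr : 1 ≤ r)

include hκ hr

theorem floor_rpow_le : ⌊(r : ℝ) ^ κ⌋₊ ≤ r :=
  Nat.floor_le_of_le (Real.rpow_le_self_of_one_le (by exact_mod_cast hr) hκ.le)

theorem floor_rpow_mul_log_le : ⌊(r : ℝ) ^ κ⌋₊ * Real.log r ≤ r * (1 / (1 - κ)) := by
  have hr0 : (0 : ℝ) < r := by exact_mod_cast hr
  have hκ' : 0 < 1 - κ := sub_pos.2 hκ
  calc ⌊(r : ℝ) ^ κ⌋₊ * Real.log r ≤ (r : ℝ) ^ κ * ((r : ℝ) ^ (1 - κ) / (1 - κ)) :=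
        mul_le_mul (Nat.floor_le (by positivity)) (Real.log_le_rpow_div hr0.le hκ')
          (Real.log_natCast_nonneg r) (by positivity)
    _ = r * (1 / (1 - κ)) := by
        rw [mul_div_assoc', ← Real.rpow_add hr0, add_sub_cancel, Real.rpow_one, mul_one_div]

theorem le_mul_of_le_add_floor_rpow {k k₀ k₁ k₂ : ℕ}
    (hk : k ≤ k₀ + k₁ * ⌊(r : ℝ) ^ κ⌋₊ + k₂ * r) : k ≤ (k₀ + k₁ + k₂) * r := by
  have hfloor := floor_rpow_le hκ hr
  calc k ≤ k₀ * 1 + k₁ * ⌊(r : ℝ) ^ κ⌋₊ + k₂ * r := by rwa [mul_one]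
    _ ≤ k₀ * r + k₁ * r + k₂ * r := by gcongr
    _ = (k₀ + k₁ + k₂) * r := by ring

end FloorRpow

theorem mul_rpow_pow_eq_exp {b x : ℝ} (hb : 0 < b) (hx : 0 < x) (θ : ℝ) (n : ℕ) :
    (b * x ^ θ) ^ n = Real.exp (n * (Real.log b + θ * Real.log x)) := by
  rw [Real.exp_nat_mul, Real.exp_add, Real.exp_log hb, mul_comm θ, Real.rpow_def_of_pos hx]

section GrowsAtLeast

theorem GrowsAtLeast.mono {θ : ℝ} {x y : ℕ → ℝ} (h : GrowsAtLeast θ x) (hxy : x ≤ᶠ[atTop] y) :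
    GrowsAtLeast θ y :=
  h.imp fun _ hC => by filter_upwards [hC, hxy] with r h h' using h.trans h'

theorem GrowsAtLeast.mul {θ θ' : ℝ} {x y : ℕ → ℝ} (hx : GrowsAtLeast θ x)
    (hy : GrowsAtLeast θ' y) : GrowsAtLeast (θ + θ') fun r => x r * y r := by
  obtain ⟨C, hC⟩ := hx
  obtain ⟨C', hC'⟩ := hy
  refine ⟨C + C', ?_⟩
  filter_upwards [hC, hC'] with r hr hr'
  calc Real.exp (r * ((θ + θ') * Real.log r - (C + C')))
      = Real.exp (r * (θ * Real.log r - C)) * Real.exp (r * (θ' * Real.log r - C')) := by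
        rw [← Real.exp_add]
        ring_nf
    _ ≤ x r * y r := mul_le_mul hr hr' (Real.exp_nonneg _) ((Real.exp_nonneg _).trans hr)

theorem growsAtLeast_const {a : ℝ} (ha : 0 < a) : GrowsAtLeast 0 fun _ => a := by
  refine ⟨|Real.log a|, ?_⟩
  filter_upwards [eventually_ge_atTop 1] with r hr
  rw [← Real.le_log_iff_exp_le ha]
  have hr1 : (1 : ℝ) ≤ r := by exact_mod_cast hr
  nlinarith [neg_abs_le (Real.log a), abs_nonneg (Real.log a)]

theorem growsAtLeast_pow {b : ℝ} (hb : 0 < b) (θ : ℝ) (N : ℕ) :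
    GrowsAtLeast (N * θ) fun r => (b * (r : ℝ) ^ θ) ^ (N * r) := by
  refine ⟨-(N * Real.log b), ?_⟩
  filter_upwards [eventually_gt_atTop 0] with r hr
  rw [mul_rpow_pow_eq_exp hb (Nat.cast_pos.2 hr), Nat.cast_mul]
  exact le_of_eq (by ring_nf)

theorem growsAtLeast_pow_floor {κ b : ℝ} (hκ : κ < 1) (hb : 0 < b) (θ : ℝ) (N : ℕ) :
    GrowsAtLeast 0 fun r => (b * (r : ℝ) ^ θ) ^ (N * ⌊(r : ℝ) ^ κ⌋₊) := by
  refine ⟨N * (|Real.log b| + |θ| * (1 / (1 - κ))), ?_⟩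
  filter_upwards [eventually_ge_atTop 1] with r hr
  rw [mul_rpow_pow_eq_exp hb (Nat.cast_pos.2 hr), Real.exp_le_exp, Nat.cast_mul]
  set n : ℕ := ⌊(r : ℝ) ^ κ⌋₊
  have hn : (n : ℝ) ≤ r := by exact_mod_cast floor_rpow_le hκ hr
  have hlog := floor_rpow_mul_log_le hκ hr
  have hlogb : -(r * |Real.log b|) ≤ n * Real.log b := calc
    -(r * |Real.log b|) ≤ -(n * |Real.log b|) := by gcongr
    _ = n * -|Real.log b| := by ring
    _ ≤ n * Real.log b := by
      gcongr
      exact neg_abs_le _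
  have hlogr : -(|θ| * (r * (1 / (1 - κ)))) ≤ θ * (n * Real.log r) := calc
    -(|θ| * (r * (1 / (1 - κ)))) ≤ -(|θ| * (n * Real.log r)) := by gcongr
    _ = -|θ| * (n * Real.log r) := by ring
    _ ≤ θ * (n * Real.log r) := mul_le_mul_of_nonneg_right (neg_abs_le θ)
      (mul_nonneg n.cast_nonneg (Real.log_natCast_nonneg r))
  nlinarith [mul_le_mul_of_nonneg_left (add_le_add hlogb hlogr) (N.cast_nonneg (α := ℝ))]

theorem growsAtLeast_factorial_pow {N : ℕ} (hN : 1 ≤ N) (n : ℕ) :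
    GrowsAtLeast (N * n) fun r => ((N * r)! : ℝ) ^ n := by
  refine ⟨N * n, ?_⟩
  filter_upwards [eventually_gt_atTop 0] with r hr
  have hpow : (r : ℝ) ^ (N * r) ≤ Real.exp ((N * r : ℕ) : ℝ) * (N * r)! := by
    have hexp := Real.pow_div_factorial_le_exp ((N * r : ℕ) : ℝ) (by positivity) (N * r)
    rw [div_le_iff₀ (by positivity)] at hexp
    refine le_trans ?_ hexp
    gcongr
    exact Nat.le_mul_of_pos_left r hN
  have hlog : (N * r : ℝ) * (Real.log r - 1) ≤ Real.log (N * r)! := by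
    have hle := Real.log_le_log (by positivity) hpow
    rw [Real.log_pow, Real.log_mul (by positivity) (by positivity), Real.log_exp] at hle
    push_cast at hle
    linarith
  rw [← Real.le_log_iff_exp_le (by positivity), Real.log_pow]
  calc (r : ℝ) * (N * n * Real.log r - N * n) = n * (N * r * (Real.log r - 1)) := by ring
    _ ≤ n * Real.log (N * r)! := by gcongr

theorem growsAtLeast_pow_floor_mul_factorial_pow {κ b : ℝ} (hκ : κ < 1) (hb : 0 < b) (θ : ℝ)
    (N n : ℕ) : GrowsAtLeast 0 fun r =>
      (b * (r : ℝ) ^ θ) ^ (N * ⌊(r : ℝ) ^ κ⌋₊) * ((N * ⌊(r : ℝ) ^ κ⌋₊)! : ℝ) ^ n :=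
  (growsAtLeast_pow_floor hκ hb θ N).mono <| .of_forall fun r =>
    le_mul_of_one_le_right (by positivity)
      (one_le_pow₀ (by exact_mod_cast Nat.one_le_iff_ne_zero.2 (Nat.factorial_ne_zero _)))

theorem growsAtLeast_pow_mul_factorial_pow {b : ℝ} (hb : 0 < b) (θ : ℝ) {N : ℕ} (hN : 1 ≤ N)
    (n : ℕ) : GrowsAtLeast (N * (θ + n)) fun r =>
      (b * (r : ℝ) ^ θ) ^ (N * r) * ((N * r)! : ℝ) ^ n := by
  rw [mul_add]
  exact (growsAtLeast_pow hb θ N).mul (growsAtLeast_factorial_pow hN n)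

end GrowsAtLeast

section GrowsAtMost

theorem GrowsAtMost.mono {θ : ℝ} {x y : ℕ → ℝ} (h : GrowsAtMost θ y) (hxy : x ≤ᶠ[atTop] y) :
    GrowsAtMost θ x :=
  h.imp fun _ hC => hxy.trans hC

theorem GrowsAtMost.mul {θ θ' : ℝ} {x y : ℕ → ℝ} (hx : GrowsAtMost θ x) (hy : GrowsAtMost θ' y)
    (hy0 : ∀ r, 0 ≤ y r) : GrowsAtMost (θ + θ') fun r => x r * y r := by
  obtain ⟨C, hC⟩ := hx
  obtain ⟨C', hC'⟩ := hy
  refine ⟨C + C', ?_⟩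
  filter_upwards [hC, hC'] with r hr hr'
  calc x r * y r
      ≤ Real.exp (r * (θ * Real.log r + C)) * Real.exp (r * (θ' * Real.log r + C')) :=
        mul_le_mul hr hr' (hy0 r) (Real.exp_nonneg _)
    _ = Real.exp (r * ((θ + θ') * Real.log r + (C + C'))) := by
        rw [← Real.exp_add]
        ring_nf

theorem GrowsAtMost.rpow {θ e : ℝ} {x : ℕ → ℝ} (hx : GrowsAtMost θ x) (hx0 : ∀ r, 0 ≤ x r)
    (he : 0 ≤ e) : GrowsAtMost (θ * e) fun r => x r ^ e := by
  obtain ⟨C, hC⟩ := hx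
  refine ⟨C * e, hC.mono fun r hr => ?_⟩
  calc x r ^ e ≤ Real.exp (r * (θ * Real.log r + C)) ^ e := Real.rpow_le_rpow (hx0 r) hr he
    _ = Real.exp (r * (θ * e * Real.log r + C * e)) := by
        rw [← Real.exp_mul]
        ring_nf

theorem growsAtMost_const (a : ℝ) : GrowsAtMost 0 fun _ => a := by
  refine ⟨|a|, ?_⟩
  filter_upwards [eventually_ge_atTop 1] with r hr
  have hr1 : (1 : ℝ) ≤ r := by exact_mod_cast hr
  have hexp := Real.add_one_le_exp (r * (0 * Real.log r + |a|))
  nlinarith [le_abs_self a, abs_nonneg a]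

theorem growsAtMost_pow {R b : ℝ} (hR : 1 ≤ R) {k : ℕ → ℕ}
    (hk : ∀ᶠ r : ℕ in atTop, (k r : ℝ) ≤ b * r) : GrowsAtMost 0 fun r => R ^ k r := by
  refine ⟨b * Real.log R, hk.mono fun r hr => ?_⟩
  rw [← Real.log_le_iff_le_exp (by positivity), Real.log_pow]
  calc k r * Real.log R ≤ b * r * Real.log R := by
        gcongr
        exact Real.log_nonneg hR
    _ = r * (0 * Real.log r + b * Real.log R) := by ring

theorem growsAtMost_factorial {κ : ℝ} (hκ : κ < 1) {a b N : ℕ} {k : ℕ → ℕ}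
    (hk : ∀ r, k r ≤ a + b * ⌊(r : ℝ) ^ κ⌋₊ + N * r) : GrowsAtMost N fun r => ((k r)! : ℝ) := by
  set A : ℝ := a + b + N + 1
  have hA : 1 ≤ A := le_add_of_nonneg_left (by positivity)
  refine ⟨A * Real.log A + a + b * (1 / (1 - κ)), ?_⟩
  filter_upwards [eventually_ge_atTop 1] with r hr
  have hkr : (k r : ℝ) ≤ a + b * ⌊(r : ℝ) ^ κ⌋₊ + N * r := by exact_mod_cast hk r
  have hr1 : (1 : ℝ) ≤ r := by exact_mod_cast hr
  have hr0 : (0 : ℝ) < r := one_pos.trans_le hr1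
  have hkA : (k r : ℝ) ≤ A * r := calc
    (k r : ℝ) ≤ (a + b + N) * r := by exact_mod_cast le_mul_of_le_add_floor_rpow hκ hr (hk r)
    _ ≤ A * r := by
      gcongr
      exact le_add_of_nonneg_right zero_le_one
  have hlog : Real.log (k r)! ≤ k r * (Real.log A + Real.log r) := by
    rw [← Real.log_mul (by positivity) hr0.ne', ← Real.log_pow]
    refine Real.log_le_log (by positivity) ?_
    calc ((k r)! : ℝ) ≤ (k r : ℝ) ^ k r := by exact_mod_cast Nat.factorial_le_pow (k r)
      _ ≤ (A * r) ^ k r := by gcongr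
  have hklogA : k r * Real.log A ≤ A * r * Real.log A := by
    gcongr
    exact Real.log_nonneg hA
  have hklogr : k r * Real.log r ≤ a * r + b * (r * (1 / (1 - κ))) + N * r * Real.log r := calc
    k r * Real.log r ≤ (a + b * ⌊(r : ℝ) ^ κ⌋₊ + N * r) * Real.log r := by gcongr
    _ = a * Real.log r + b * (⌊(r : ℝ) ^ κ⌋₊ * Real.log r) + N * r * Real.log r := by ring
    _ ≤ a * r + b * (r * (1 / (1 - κ))) + N * r * Real.log r := by
      gcongr a * ?_ + b * ?_ + _
      · exact Real.log_le_self hr0.le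
      · exact floor_rpow_mul_log_le hκ hr
  rw [← Real.log_le_iff_le_exp (by positivity)]
  linarith

theorem growsAtMost_of_le_gevrey {u : ℕ → ℕ → ℝ} {M R e e' κ : ℝ} (hR : 1 ≤ R) (he : 0 ≤ e)
    (he' : 0 ≤ e')
    (hu : ∀ k l, u k l ≤ M * R ^ (k + l) * ((k ! : ℝ) ^ e * (l ! : ℝ) ^ e')) (hκ : κ < 1)
    {k l : ℕ → ℕ} {k₀ k₁ k₂ l₀ l₁ l₂ : ℕ}
    (hk : ∀ r, k r ≤ k₀ + k₁ * ⌊(r : ℝ) ^ κ⌋₊ + k₂ * r)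
    (hl : ∀ r, l r ≤ l₀ + l₁ * ⌊(r : ℝ) ^ κ⌋₊ + l₂ * r) :
    GrowsAtMost (k₂ * e + l₂ * e') fun r => u (k r) (l r) := by
  have hlin : ∀ᶠ r : ℕ in atTop,
      ((k r + l r : ℕ) : ℝ) ≤ ((k₀ + k₁ + k₂ + (l₀ + l₁ + l₂) : ℕ) : ℝ) * r := by
    filter_upwards [eventually_ge_atTop 1] with r hr
    have hsum := add_le_add (le_mul_of_le_add_floor_rpow hκ hr (hk r))
      (le_mul_of_le_add_floor_rpow hκ hr (hl r))
    rw [← add_mul] at hsum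
    exact_mod_cast hsum
  have hgeom := (growsAtMost_const M).mul (growsAtMost_pow hR hlin) fun r => by positivity
  have hfac := ((growsAtMost_factorial hκ hk).rpow (fun r => by positivity) he).mul
    ((growsAtMost_factorial hκ hl).rpow (fun r => by positivity) he') fun r => by positivity
  have hbound := (hgeom.mul hfac fun r => by positivity).mono (.of_forall fun r => hu _ _)
  rwa [add_zero, zero_add] at hbound

end GrowsAtMost

/-! ### Gevrey estimates -/

theorem exists_norm_le_of_eventually_summable {a : ℕ × ℕ → ℂ}
    (ha : ∀ᶠ z : ℂ × ℂ in 𝓝 0, Summable fun n : ℕ × ℕ => a n * z.1 ^ n.1 * z.2 ^ n.2) :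
    ∃ M > 0, ∃ R ≥ 1, ∀ n, ‖a n‖ ≤ M * R ^ (n.1 + n.2) := by
  have hdiag : Continuous fun ρ : ℝ => ((ρ : ℂ), (ρ : ℂ)) := by fun_prop
  obtain ⟨ρ, hsum, hρ0, hρ1⟩ := ((((hdiag.tendsto' 0 0 (by simp)).eventually ha).filter_mono
    nhdsWithin_le_nhds).and (Ioo_mem_nhdsGT (zero_lt_one (α := ℝ)))).exists
  set S : ℝ := ∑' n : ℕ × ℕ, ‖a n * (ρ : ℂ) ^ n.1 * (ρ : ℂ) ^ n.2‖
  refine ⟨S + 1, by positivity, ρ⁻¹, (one_le_inv₀ hρ0).2 hρ1.le, fun n => ?_⟩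
  have hle : ‖a n‖ * ρ ^ (n.1 + n.2) ≤ S + 1 := calc
    ‖a n‖ * ρ ^ (n.1 + n.2) = ‖a n * (ρ : ℂ) ^ n.1 * (ρ : ℂ) ^ n.2‖ := by
      rw [mul_assoc, ← pow_add, norm_mul, norm_pow, Complex.norm_of_nonneg hρ0.le]
    _ ≤ S := hsum.norm.le_tsum n fun _ _ => norm_nonneg _
    _ ≤ S + 1 := (lt_add_one S).le
  rwa [inv_pow, ← div_eq_mul_inv, le_div_iff₀ (by positivity)]

theorem eventually_summable_of_norm_le {a : ℕ × ℕ → ℂ} {M R : ℝ} (hR : 0 < R)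
    (ha : ∀ n, ‖a n‖ ≤ M * R ^ (n.1 + n.2)) :
    ∀ᶠ z : ℂ × ℂ in 𝓝 0, Summable fun n : ℕ × ℕ => a n * z.1 ^ n.1 * z.2 ^ n.2 := by
  filter_upwards [Metric.ball_mem_nhds (0 : ℂ × ℂ) (by positivity : 0 < 1 / (2 * R))] with z hz
  rw [mem_ball_zero_iff, Prod.norm_def, max_lt_iff] at hz
  have hsum : Summable fun n : ℕ × ℕ => M * ((1 / 2 : ℝ) ^ n.1 * (1 / 2 : ℝ) ^ n.2) :=
    (summable_geometric_two.mul_of_nonneg summable_geometric_two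
      (fun _ => by positivity) (fun _ => by positivity)).mul_left M
  refine hsum.of_norm_bounded fun n => ?_
  have hMR : 0 ≤ M * R ^ (n.1 + n.2) := (norm_nonneg _).trans (ha n)
  calc ‖a n * z.1 ^ n.1 * z.2 ^ n.2‖ = ‖a n‖ * ‖z.1‖ ^ n.1 * ‖z.2‖ ^ n.2 := by simp
    _ ≤ M * R ^ (n.1 + n.2) * (1 / (2 * R)) ^ n.1 * (1 / (2 * R)) ^ n.2 := by
        gcongr
        exacts [ha n, hz.1.le, hz.2.le]
    _ = M * ((R * (1 / (2 * R))) ^ n.1 * (R * (1 / (2 * R))) ^ n.2) := by ring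
    _ = M * ((1 / 2 : ℝ) ^ n.1 * (1 / 2 : ℝ) ^ n.2) := by
        rw [show R * (1 / (2 * R)) = 1 / 2 by field_simp]

theorem inGevrey_iff {s σ : ℝ} {u : Series} :
    InGevrey s σ u ↔ ∃ M > 0, ∃ R ≥ 1, ∀ k l, ‖cf u k l‖
      ≤ M * R ^ (k + l) * ((k ! : ℝ) ^ (s - 1) * (l ! : ℝ) ^ (σ - 1)) := by
  have hnorm (M R : ℝ) (k l : ℕ) :
      ‖cf u k l / (((k ! : ℝ) ^ (s - 1) * (l ! : ℝ) ^ (σ - 1) : ℝ) : ℂ)‖ ≤ M * R ^ (k + l)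
        ↔ ‖cf u k l‖ ≤ M * R ^ (k + l) * ((k ! : ℝ) ^ (s - 1) * (l ! : ℝ) ^ (σ - 1)) := by
    rw [norm_div, Complex.norm_of_nonneg (by positivity), div_le_iff₀ (by positivity)]
  refine ⟨fun hu => ?_, fun ⟨M, _, R, hR, hle⟩ => ?_⟩
  · obtain ⟨M, hM, R, hR, hle⟩ := exists_norm_le_of_eventually_summable hu
    exact ⟨M, hM, R, hR, fun k l => (hnorm M R k l).1 (hle (k, l))⟩
  · exact eventually_summable_of_norm_le (one_pos.trans_le hR)
      fun n => (hnorm M R n.1 n.2).2 (hle n.1 n.2)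

/-! ### The model equations -/

/-- The common form of the two model equations. The source is `A x ^ l₀ t`, and the operator in
`x ∂_x` of the second term multiplies `x ^ l` by `g l`; the factors `g l = [l]_β` and `g l = l ^ β`
give `[x ∂_x]_β` and `(x ∂_x) ^ β`. -/
structure ModelEquation where
  (m p q μ h β j α l₀ : ℕ)
  c : ℕ × ℕ → ℝ
  (A B C : ℝ)
  g : ℕ → ℝ
  c_nonpos : ∀ v ∈ Im m, c v ≤ 0
  A_pos : 0 < A
  B_pos : 0 < B
  C_pos : 0 < C
  p_pos : 1 ≤ p
  q_pos : 1 ≤ q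
  hβ_mem : (h, β) ∈ Im m
  hβ_notMem : ((h : ℝ), (β : ℝ)) ∉ newtonPolygon m c
  jα_mem : (j, α) ∈ Im m
  μ_lt_α : μ < α
  descFactorial_le_g : ∀ l, (l.descFactorial β : ℝ) ≤ g l
  g_le_pow : ∀ l, g l ≤ (l : ℝ) ^ β
  g_pos : ∀ l, l₀ ≤ l → 0 < g l

namespace ModelEquation

variable (E : ModelEquation)

/-- The recurrence satisfied by the coefficients of the formal solution. -/
def recurrence : Recurrence ℝ where
  p := E.p
  q := E.q
  μ := E.μ
  α := E.α
  p_pos := E.p_pos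
  q_pos := E.q_pos
  P := symbol E.m E.c
  f k l := if k = 1 ∧ l = E.l₀ then E.A else 0
  b k l := E.B * (k : ℝ) ^ E.h * E.g l
  e k l := E.C * (k : ℝ) ^ E.j * l.descFactorial E.α

/-- The number `d`, the vertical distance from `(h, β)` to the Newton polygon. -/
def d : ℝ := height E.m E.c E.h E.β

/-- The loss of powers of `x` in the last term of the equation. -/
def δ : ℕ := E.α - E.μ

theorem h_lt_m : E.h < E.m := (mem_Im.1 E.hβ_mem).1

theorem j_lt_m : E.j < E.m := (mem_Im.1 E.jα_mem).1

theorem μ_add_δ : E.μ + E.δ = E.α := Nat.add_sub_cancel' E.μ_lt_α.le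

theorem δ_pos : 0 < E.δ := Nat.sub_pos_of_lt E.μ_lt_α

theorem d_pos : 0 < E.d := height_pos E.h_lt_m.le E.hβ_notMem

theorem g_nonneg (l : ℕ) : 0 ≤ E.g l := (Nat.cast_nonneg _).trans (E.descFactorial_le_g l)

theorem isPositive : E.recurrence.IsPositive where
  P_pos _ l hk := symbol_pos E.c_nonpos hk l
  f_nonneg k l := by
    dsimp only [recurrence]
    split_ifs
    exacts [E.A_pos.le, le_rfl]
  b_nonneg k l := mul_nonneg (mul_nonneg E.B_pos.le (by positivity)) (E.g_nonneg l)
  e_nonneg k l := mul_nonneg (mul_nonneg E.C_pos.le (by positivity)) (by positivity)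

/-! ### The upper bound -/

/-- The majorant of the solution. Its parameters are dictated by the shifts of the recurrence: `e`
compensates the excess `d` of the term with shift `p`, and `ν` and `τ` the powers of `k` and `l` in
the term with shift `q`. -/
def weight : ℕ → ℕ → ℝ :=
  gevreyWeight E.α ((E.m - E.j) / E.q) ((E.α + E.d / E.p * E.δ) / (E.α * E.q)) (E.d / E.p)

theorem exists_x_shift_weight_le : ∃ K ≥ 0, ∀ k l, 1 ≤ k → E.recurrence.b k l * E.weight k l
    ≤ K * (symbol E.m E.c k (l + E.p) * E.weight k (l + E.p)) := by
  have hp : (0 : ℝ) < E.p := by exact_mod_cast E.p_pos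
  have hd := E.d_pos
  have hB := E.B_pos
  obtain ⟨K, hK, hle⟩ := exists_pow_mul_pow_le_rpow_height_mul_symbol E.c_nonpos E.h_lt_m.le E.β
  refine ⟨E.B * K * ((E.p : ℝ) ^ E.p) ^ (E.d / E.p), by positivity, fun k l hk => ?_⟩
  have hshift := gevreyWeight_x_shift (τ := (E.α + E.d / E.p * E.δ) / (E.α * E.q))
    (e := E.d / E.p) (by positivity) (by positivity) E.α ((E.m - E.j) / E.q) k l E.p
  rw [mul_div_cancel₀ _ hp.ne'] at hshift
  have hw : 0 < E.weight k l := gevreyWeight_pos _ _ _ _ k l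
  have hsymbol := symbol_pos E.c_nonpos hk (l + E.p)
  calc E.B * (k : ℝ) ^ E.h * E.g l * E.weight k l
      ≤ E.B * ((k : ℝ) ^ E.h * ((l + E.p : ℕ) : ℝ) ^ E.β) * E.weight k l := by
        rw [mul_assoc E.B]
        gcongr
        exact (E.g_le_pow l).trans (by gcongr; exact Nat.le_add_right l _)
    _ ≤ E.B * (K * ((l + E.p : ℕ) : ℝ) ^ E.d * symbol E.m E.c k (l + E.p)) * E.weight k l := by
        gcongr E.B * ?_ * _
        exact hle k (l + E.p) hk (E.p_pos.trans (Nat.le_add_left _ l))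
    _ = E.B * K * symbol E.m E.c k (l + E.p)
        * (((l + E.p : ℕ) : ℝ) ^ E.d * E.weight k l) := by ring
    _ ≤ E.B * K * symbol E.m E.c k (l + E.p)
        * (((E.p : ℝ) ^ E.p) ^ (E.d / E.p) * E.weight k (l + E.p)) :=
        mul_le_mul_of_nonneg_left hshift (by positivity)
    _ = E.B * K * ((E.p : ℝ) ^ E.p) ^ (E.d / E.p)
        * (symbol E.m E.c k (l + E.p) * E.weight k (l + E.p)) := by ring

theorem weight_t_shift (k l : ℕ) : ((l : ℝ) + 1) ^ E.α * E.weight k (l + E.δ)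
    ≤ ((E.δ : ℝ) + 1) ^ (E.δ * (E.d / E.p))
      * (((k + E.q : ℕ) : ℝ) ^ (E.m - E.j) * E.weight (k + E.q) l) := by
  have hq : (0 : ℝ) < E.q := by exact_mod_cast E.q_pos
  have hα : (0 : ℝ) < E.α := by exact_mod_cast (Nat.zero_le _).trans_lt E.μ_lt_α
  have hd := E.d_pos
  have hjm : (E.j : ℝ) ≤ E.m := by exact_mod_cast E.j_lt_m.le
  have hδ : E.δ ≤ E.α * E.q := (Nat.sub_le _ _).trans (Nat.le_mul_of_pos_right _ E.q_pos)
  have hshift := gevreyWeight_t_shift (ν := (E.m - E.j) / E.q)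
    (τ := (E.α + E.d / E.p * E.δ) / (E.α * E.q)) (e := E.d / E.p)
    (div_nonneg (sub_nonneg.2 hjm) hq.le) (by positivity) (by positivity) hδ k l
  have hexp_l : E.α * E.q * ((E.α + E.d / E.p * E.δ) / (E.α * E.q)) - E.δ * (E.d / E.p)
      = (E.α : ℝ) := by
    rw [mul_div_cancel₀ _ (by positivity)]
    ring
  have hexp_k : E.q * ((E.m - E.j) / E.q) = ((E.m - E.j : ℕ) : ℝ) := by
    rw [mul_div_cancel₀ _ hq.ne', Nat.cast_sub E.j_lt_m.le]
  rwa [hexp_l, hexp_k, Real.rpow_natCast, Real.rpow_natCast] at hshift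

theorem exists_t_shift_weight_le : ∃ K ≥ 0, ∀ k l,
    E.recurrence.e k (l + E.α) * E.weight k (l + E.α)
      ≤ K * (symbol E.m E.c (k + E.q) (l + E.μ) * E.weight (k + E.q) (l + E.μ)) := by
  have hC := E.C_pos
  refine ⟨E.C * (E.α + 1) ^ E.α * ((E.δ : ℝ) + 1) ^ (E.δ * (E.d / E.p)), by positivity,
    fun k l => ?_⟩
  set K₀ : ℝ := ((E.δ : ℝ) + 1) ^ (E.δ * (E.d / E.p))
  have hw (k l : ℕ) : 0 < E.weight k l := gevreyWeight_pos _ _ _ _ k l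
  have hwk := hw k (l + E.α)
  have hwk' := hw (k + E.q) (l + E.μ)
  have hfall : ((l + E.α).descFactorial E.α : ℝ)
      ≤ (((E.α : ℝ) + 1) * ((l + E.μ : ℕ) + 1)) ^ E.α := calc
    _ ≤ ((l + E.α : ℕ) : ℝ) ^ E.α := by exact_mod_cast Nat.descFactorial_le_pow _ _
    _ ≤ (((E.α : ℝ) + 1) * ((l + E.μ : ℕ) + 1)) ^ E.α := by
      gcongr
      push_cast
      nlinarith
  have hshift := E.weight_t_shift k (l + E.μ)
  rw [add_assoc, E.μ_add_δ] at hshift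
  calc E.C * (k : ℝ) ^ E.j * (l + E.α).descFactorial E.α * E.weight k (l + E.α)
      ≤ E.C * ((k + E.q : ℕ) : ℝ) ^ E.j * (((E.α : ℝ) + 1) * ((l + E.μ : ℕ) + 1)) ^ E.α
        * E.weight k (l + E.α) := by
        gcongr
        exact Nat.le_add_right _ _
    _ = E.C * (E.α + 1) ^ E.α * ((k + E.q : ℕ) : ℝ) ^ E.j
        * (((l + E.μ : ℕ) + 1 : ℝ) ^ E.α * E.weight k (l + E.α)) := by
        rw [mul_pow]
        ring
    _ ≤ E.C * (E.α + 1) ^ E.α * ((k + E.q : ℕ) : ℝ) ^ E.j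
        * (K₀ * (((k + E.q : ℕ) : ℝ) ^ (E.m - E.j) * E.weight (k + E.q) (l + E.μ))) := by
        gcongr
    _ = E.C * (E.α + 1) ^ E.α * K₀
        * (((k + E.q : ℕ) : ℝ) ^ E.m * E.weight (k + E.q) (l + E.μ)) := by
        rw [← pow_mul_pow_sub _ E.j_lt_m.le]
        ring
    _ ≤ E.C * (E.α + 1) ^ E.α * K₀
        * (symbol E.m E.c (k + E.q) (l + E.μ) * E.weight (k + E.q) (l + E.μ)) := by
        gcongr
        exact pow_le_symbol E.c_nonpos _ _

variable {E} {a : ℕ → ℕ → ℝ} (ha : E.recurrence.IsSolution a)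

include ha

theorem exists_solution_le_weight :
    ∃ M > 0, ∃ ρ ≥ 1, ∀ k l, a k l ≤ M * ρ ^ (k + l) * E.weight k l := by
  have hw (k l : ℕ) : 0 < E.weight k l := gevreyWeight_pos _ _ _ _ k l
  obtain ⟨K₁, hK₁, hb⟩ := E.exists_x_shift_weight_le
  obtain ⟨K₂, hK₂, he⟩ := E.exists_t_shift_weight_le
  have hPw (k l : ℕ) (hk : 1 ≤ k) : 0 < symbol E.m E.c k l * E.weight k l :=
    mul_pos (symbol_pos E.c_nonpos hk l) (hw k l)
  have hA := E.A_pos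
  refine ha.exists_le_geometric_mul E.isPositive (fun k l => (hw k l).le)
    (div_pos hA (hPw 1 E.l₀ le_rfl)) hK₁ hK₂ (fun k l hk => ?_) hb he
  dsimp only [recurrence]
  split_ifs with hkl
  · rw [hkl.1, hkl.2, div_mul_cancel₀ _ (hPw 1 E.l₀ le_rfl).ne']
  · exact mul_nonneg (div_pos hA (hPw 1 E.l₀ le_rfl)).le (hPw k l hk).le

theorem exists_solution_le : ∃ M > 0, ∃ ρ ≥ 1, ∀ k l, a k l ≤ M * ρ ^ (k + l)
    * ((k ! : ℝ) ^ ((E.j + E.α + E.d / E.p * E.δ - E.m) / E.q) * (l ! : ℝ) ^ (E.d / E.p)) := by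
  have hd := E.d_pos
  have hq : (0 : ℝ) < E.q := by exact_mod_cast E.q_pos
  have hα : (0 : ℝ) < E.α := by exact_mod_cast (Nat.zero_le _).trans_lt E.μ_lt_α
  obtain ⟨M, hM, ρ, hρ, hle⟩ := exists_solution_le_weight ha
  obtain ⟨c, hc, hweight⟩ := exists_gevreyWeight_le
    (τ := (E.α + E.d / E.p * E.δ) / (E.α * E.q)) (by positivity) E.α ((E.m - E.j) / E.q) (E.d / E.p)
  have hexp : E.α * ((E.α + E.d / E.p * E.δ) / (E.α * E.q)) - (E.m - E.j) / E.q
      = (E.j + E.α + E.d / E.p * E.δ - E.m) / E.q := by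
    field_simp
    ring
  rw [hexp] at hweight
  refine ⟨M, hM, ρ * c, one_le_mul_of_one_le_of_one_le hρ hc, fun k l => (hle k l).trans ?_⟩
  rw [mul_pow, ← mul_assoc M, mul_assoc (M * ρ ^ (k + l))]
  gcongr
  exact hweight k l

end ModelEquation

/-! ### The lower bound -/

theorem pow_le_descFactorial {i n l : ℕ} (h : i + n ≤ l + 1) : i ^ n ≤ l.descFactorial n :=
  (Nat.pow_le_pow_left (Nat.le_sub_of_add_le h) n).trans (Nat.pow_sub_le_descFactorial l n)

theorem exists_eventually_symbol_le_rpow {m : ℕ} {c : ℕ × ℕ → ℝ} (hc : ∀ v ∈ Im m, c v ≤ 0)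
    {κ : ℝ} (hκ : κ < 1) {k l : ℕ → ℕ} {k₀ k₁ k₂ l₀ l₁ l₂ : ℕ}
    (hk : ∀ r, k r ≤ k₀ + k₁ * ⌊(r : ℝ) ^ κ⌋₊ + k₂ * r)
    (hl : ∀ r, l r ≤ l₀ + l₁ * ⌊(r : ℝ) ^ κ⌋₊ + l₂ * r) :
    ∃ Y > 0, ∀ᶠ r : ℕ in atTop, symbol m c (k r) (l r) ≤ Y * (r : ℝ) ^ (m : ℝ) := by
  refine exists_eventually_symbol_le hc (κ := 1) (a := (k₀ + k₁ + k₂ : ℕ) + 1)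
    (b := (l₀ + l₁ + l₂ : ℕ)) (by positivity) (fun v hv => ?_) ?_ ?_
  · rw [one_mul]
    exact_mod_cast le_of_mem_Lam0 hv
  · filter_upwards [eventually_ge_atTop 1] with r hr
    rw [Real.rpow_one]
    exact_mod_cast (le_mul_of_le_add_floor_rpow hκ hr (hk r)).trans
      (Nat.mul_le_mul_right r (Nat.le_succ _))
  · filter_upwards [eventually_ge_atTop 1] with r hr
    exact_mod_cast le_mul_of_le_add_floor_rpow hκ hr (hl r)

namespace ModelEquation

variable {E : ModelEquation} {a : ℕ → ℕ → ℝ} (ha : E.recurrence.IsSolution a)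

include ha

theorem solution_nonneg (k l : ℕ) : 0 ≤ a k l := ha.nonneg E.isPositive k l

theorem mul_solution_le_x_run {k l N : ℕ} {Y : ℝ} (hk : 1 ≤ k) (hl : E.β ≤ l) (hY0 : 0 < Y)
    (hY : symbol E.m E.c k (l + E.p * N) ≤ Y) :
    (E.B * (k : ℝ) ^ E.h / Y) ^ N * (N ! : ℝ) ^ E.β * a k l ≤ a k (l + E.p * N) := by
  have hB := E.B_pos
  have hprod : (E.B * (k : ℝ) ^ E.h) ^ N * (N ! : ℝ) ^ E.β
      ≤ ∏ i ∈ Finset.range N, E.B * (k : ℝ) ^ E.h * E.g (l + E.p * i) := by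
    rw [← Finset.prod_range_add_one_eq_factorial, Nat.cast_prod, ← Finset.prod_pow,
      ← Finset.pow_card_mul_prod, Finset.card_range]
    gcongr with i
    refine le_trans ?_ (E.descFactorial_le_g _)
    have hi : i ≤ E.p * i := Nat.le_mul_of_pos_left i E.p_pos
    exact_mod_cast pow_le_descFactorial (by omega)
  have hrun := ha.prod_mul_le_x_shift E.isPositive hk hY0.le fun l' hl' =>
    (symbol_mono E.c_nonpos le_rfl hl').trans hY
  rw [div_pow, div_mul_eq_mul_div, div_mul_eq_mul_div, div_le_iff₀' (by positivity)]
  exact (mul_le_mul_of_nonneg_right hprod (solution_nonneg ha k l)).trans hrun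

theorem mul_solution_le_t_run {k l N : ℕ} {Y : ℝ} (hk : 1 ≤ k) (hl : E.μ ≤ l) (hY0 : 0 < Y)
    (hY : symbol E.m E.c (k + E.q * N) (l + E.δ * N) ≤ Y) :
    (E.C / Y) ^ N * (N ! : ℝ) ^ (E.j + E.α) * a k (l + E.δ * N) ≤ a (k + E.q * N) l := by
  have hC := E.C_pos
  have hfac : (N ! : ℝ) = ∏ i ∈ Finset.range N, ((i + 1 : ℕ) : ℝ) := by
    rw [← Nat.cast_prod, Finset.prod_range_add_one_eq_factorial]
  have hfac_reflect : (N ! : ℝ) = ∏ i ∈ Finset.range N, ((N - i : ℕ) : ℝ) := by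
    rw [← Nat.cast_prod, ← Nat.descFactorial_eq_prod_range, Nat.descFactorial_self]
  have hsplit : E.C ^ N * (N ! : ℝ) ^ (E.j + E.α) = ∏ i ∈ Finset.range N,
      E.C * ((i + 1 : ℕ) : ℝ) ^ E.j * ((N - i : ℕ) : ℝ) ^ E.α := by
    rw [Finset.prod_mul_distrib, Finset.prod_mul_distrib, Finset.prod_const, Finset.card_range,
      Finset.prod_pow, Finset.prod_pow, ← hfac, ← hfac_reflect, pow_add, mul_assoc]
  have hprod : E.C ^ N * (N ! : ℝ) ^ (E.j + E.α) ≤ ∏ i ∈ Finset.range N,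
      E.C * ((k + E.q * i : ℕ) : ℝ) ^ E.j * (l + E.δ * (N - i)).descFactorial E.α := by
    rw [hsplit]
    refine Finset.prod_le_prod (fun i _ => by positivity) fun i hi => ?_
    gcongr E.C * ?_ ^ E.j * ?_
    · have hqi : i ≤ E.q * i := Nat.le_mul_of_pos_left i E.q_pos
      exact_mod_cast (by omega : i + 1 ≤ k + E.q * i)
    · obtain ⟨n, hn⟩ := Nat.exists_eq_add_of_lt (Finset.mem_range.1 hi)
      have hnδ : n ≤ E.δ * n := Nat.le_mul_of_pos_left n E.δ_pos
      have hα := E.μ_add_δ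
      rw [show N - i = n + 1 by omega, Nat.mul_succ]
      exact_mod_cast pow_le_descFactorial (by omega)
  have hrun := ha.prod_mul_le_t_shift E.isPositive E.μ_add_δ.symm hl hY0.le fun k' hk' l' hl' =>
    (symbol_mono E.c_nonpos hk' hl').trans hY
  rw [div_pow, div_mul_eq_mul_div, div_mul_eq_mul_div, div_le_iff₀' (by positivity)]
  exact (mul_le_mul_of_nonneg_right hprod (solution_nonneg ha k _)).trans hrun

theorem exists_one_solution_pos : ∃ l, E.m ≤ l ∧ 0 < a 1 l := by
  have hsource : 0 < a 1 E.l₀ := by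
    have hle := ha.source_le E.isPositive le_rfl E.l₀
    simp only [recurrence, and_self, if_true] at hle
    exact pos_of_mul_pos_right (E.A_pos.trans_le hle) (symbol_pos E.c_nonpos le_rfl _).le
  refine ⟨E.l₀ + E.p * E.m, le_add_left (Nat.le_mul_of_pos_left _ E.p_pos), ?_⟩
  have hrun := ha.prod_mul_le_x_shift E.isPositive le_rfl
    (symbol_pos E.c_nonpos le_rfl (E.l₀ + E.p * E.m)).le fun l' hl' =>
    symbol_mono E.c_nonpos le_rfl hl'
  refine pos_of_mul_pos_right
    ((mul_pos (Finset.prod_pos fun i _ => ?_) hsource).trans_le hrun)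
    (pow_pos (symbol_pos E.c_nonpos le_rfl _) _).le
  exact mul_pos (mul_pos E.B_pos (by simp)) (E.g_pos _ (Nat.le_add_right _ _))

section Path

variable {l : ℕ} {θ θ' θ₀ : ℝ} {k N : ℕ → ℕ}

theorem growsAtLeast_x_run (hl : E.β ≤ l) (hk : ∀ r, 1 ≤ k r)
    (hsymbol : ∃ Y > 0, ∀ᶠ r : ℕ in atTop,
      symbol E.m E.c (k r) (l + E.p * N r) ≤ Y * (k r : ℝ) ^ E.h * (r : ℝ) ^ (-θ))
    (hN : ∀ b > 0, GrowsAtLeast θ' fun r => (b * (r : ℝ) ^ θ) ^ N r * ((N r)! : ℝ) ^ E.β)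
    (h : GrowsAtLeast θ₀ fun r => a (k r) l) :
    GrowsAtLeast (θ' + θ₀) fun r => a (k r) (l + E.p * N r) := by
  obtain ⟨Y, hY0, hY⟩ := hsymbol
  refine ((hN (E.B / Y) (div_pos E.B_pos hY0)).mul h).mono ?_
  filter_upwards [hY, eventually_gt_atTop 0] with r hr hr0
  have hr0 : (0 : ℝ) < r := by exact_mod_cast hr0
  have hk0 : (0 : ℝ) < k r := by exact_mod_cast hk r
  have hquot : E.B / Y * (r : ℝ) ^ θ
      = E.B * (k r : ℝ) ^ E.h / (Y * (k r : ℝ) ^ E.h * (r : ℝ) ^ (-θ)) := by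
    rw [Real.rpow_neg hr0.le]
    field_simp
  rw [hquot]
  exact mul_solution_le_x_run ha (hk r) hl (by positivity) hr

theorem growsAtLeast_t_run (hl : E.μ ≤ l) (hk : ∀ r, 1 ≤ k r)
    (hsymbol : ∃ Y > 0, ∀ᶠ r : ℕ in atTop,
      symbol E.m E.c (k r + E.q * N r) (l + E.δ * N r) ≤ Y * (r : ℝ) ^ (-θ))
    (hN : ∀ b > 0, GrowsAtLeast θ' fun r => (b * (r : ℝ) ^ θ) ^ N r * ((N r)! : ℝ) ^ (E.j + E.α))
    (h : GrowsAtLeast θ₀ fun r => a (k r) (l + E.δ * N r)) :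
    GrowsAtLeast (θ' + θ₀) fun r => a (k r + E.q * N r) l := by
  obtain ⟨Y, hY0, hY⟩ := hsymbol
  refine ((hN (E.C / Y) (div_pos E.C_pos hY0)).mul h).mono ?_
  filter_upwards [hY, eventually_gt_atTop 0] with r hr hr0
  have hr0 : (0 : ℝ) < r := by exact_mod_cast hr0
  have hquot : E.C / Y * (r : ℝ) ^ θ = E.C / (Y * (r : ℝ) ^ (-θ)) := by
    rw [Real.rpow_neg hr0.le]
    field_simp
  rw [hquot]
  exact mul_solution_le_t_run ha (hk r) hl (by positivity) hr

variable {κ : ℝ} (hκ1 : κ < 1) (hl : E.m ≤ l) (hpos : 0 < a 1 l)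

include hκ1 hl hpos

theorem growsAtLeast_solution_start :
    GrowsAtLeast 0 fun r => a (1 + E.q * (E.p * ⌊(r : ℝ) ^ κ⌋₊)) l := by
  have hβ := (mem_Im.1 E.hβ_mem).2
  have hα := (mem_Im.1 E.jα_mem).2
  have hμα := E.μ_lt_α
  have hx : GrowsAtLeast 0 fun r => a 1 (l + E.p * (E.δ * ⌊(r : ℝ) ^ κ⌋₊)) := by
    have hsymbol := exists_eventually_symbol_le_rpow E.c_nonpos hκ1
      (k := fun _ => 1) (k₀ := 1) (k₁ := 0) (k₂ := 0)
      (l := fun r => l + E.p * (E.δ * ⌊(r : ℝ) ^ κ⌋₊)) (l₀ := l) (l₁ := E.p * E.δ) (l₂ := 0)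
      (by simp) (by simp [mul_assoc])
    simpa using growsAtLeast_x_run ha (by omega) (fun _ => le_rfl) (θ := -E.m)
      (by simpa using hsymbol)
      (fun b hb => growsAtLeast_pow_floor_mul_factorial_pow hκ1 hb (-E.m) E.δ E.β)
      (growsAtLeast_const hpos)
  have hsymbol := exists_eventually_symbol_le_rpow E.c_nonpos hκ1
    (k := fun r => 1 + E.q * (E.p * ⌊(r : ℝ) ^ κ⌋₊)) (k₀ := 1) (k₁ := E.q * E.p) (k₂ := 0)
    (l := fun r => l + E.δ * (E.p * ⌊(r : ℝ) ^ κ⌋₊)) (l₀ := l) (l₁ := E.δ * E.p) (l₂ := 0)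
    (by simp [mul_assoc]) (by simp [mul_assoc])
  simpa using growsAtLeast_t_run ha (k := fun _ => 1) (by omega) (fun _ => le_rfl) (θ := -E.m)
    (by simpa using hsymbol)
    (fun b hb => growsAtLeast_pow_floor_mul_factorial_pow hκ1 hb (-E.m) E.p (E.j + E.α))
    (by simpa only [mul_left_comm E.p] using hx)

variable (hκ0 : 0 ≤ κ)
  (hκ : ∀ v ∈ Lam0 E.m E.c, κ * v.1 + v.2 ≤ κ * E.h + E.β - E.d)

include hκ0 hκ

theorem growsAtLeast_solution_x : GrowsAtLeast (E.δ * E.d) fun r =>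
    a (1 + E.q * (E.p * ⌊(r : ℝ) ^ κ⌋₊)) (l + E.p * (E.δ * r)) := by
  have hβ := (mem_Im.1 E.hβ_mem).2
  obtain ⟨Y, hY0, hY⟩ := exists_eventually_symbol_le E.c_nonpos (a := 1 + E.q * E.p)
    (b := (l + E.p * E.δ : ℕ)) (by positivity) hκ
    (k := fun r => 1 + E.q * (E.p * ⌊(r : ℝ) ^ κ⌋₊)) (l := fun r => l + E.p * (E.δ * r))
    (by
      filter_upwards [eventually_ge_atTop 1] with r hr
      have hr1 : 1 ≤ (r : ℝ) ^ κ := Real.one_le_rpow (by exact_mod_cast hr) hκ0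
      have hfloor : (⌊(r : ℝ) ^ κ⌋₊ : ℝ) ≤ (r : ℝ) ^ κ := Nat.floor_le (by positivity)
      push_cast
      rw [add_mul, one_mul, mul_assoc]
      gcongr)
    (by
      filter_upwards [eventually_ge_atTop 1] with r hr
      have hlr : l ≤ l * r := Nat.le_mul_of_pos_right l hr
      exact_mod_cast (by linarith : l + E.p * (E.δ * r) ≤ (l + E.p * E.δ) * r))
  have hsymbol : ∀ᶠ r : ℕ in atTop,
      symbol E.m E.c (1 + E.q * (E.p * ⌊(r : ℝ) ^ κ⌋₊)) (l + E.p * (E.δ * r))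
        ≤ Y * ((1 + E.q * (E.p * ⌊(r : ℝ) ^ κ⌋₊) : ℕ) : ℝ) ^ E.h * (r : ℝ) ^ (-(E.d - E.β)) := by
    filter_upwards [hY, eventually_gt_atTop 0] with r hr hr0
    have hr0 : (0 : ℝ) < r := by exact_mod_cast hr0
    have hfloor : ⌊(r : ℝ) ^ κ⌋₊ ≤ E.q * (E.p * ⌊(r : ℝ) ^ κ⌋₊) :=
      (Nat.le_mul_of_pos_left _ E.p_pos).trans (Nat.le_mul_of_pos_left _ E.q_pos)
    have hk : (r : ℝ) ^ κ ≤ (1 + E.q * (E.p * ⌊(r : ℝ) ^ κ⌋₊) : ℕ) :=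
      (Nat.lt_floor_add_one _).le.trans (by exact_mod_cast (by omega))
    calc _ ≤ Y * (r : ℝ) ^ (κ * E.h + E.β - E.d) := hr
      _ = Y * ((r : ℝ) ^ κ) ^ E.h * (r : ℝ) ^ (-(E.d - E.β)) := by
        rw [← Real.rpow_mul_natCast hr0.le, mul_assoc, ← Real.rpow_add hr0]
        ring_nf
      _ ≤ _ := by gcongr
  have hN (b : ℝ) (hb : 0 < b) :=
    growsAtLeast_pow_mul_factorial_pow hb (E.d - E.β) E.δ_pos E.β
  rw [sub_add_cancel] at hN
  simpa using growsAtLeast_x_run ha (by omega) (fun _ => Nat.le_add_right 1 _) ⟨Y, hY0, hsymbol⟩ hN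
    (growsAtLeast_solution_start ha hκ1 hl hpos)

theorem growsAtLeast_solution_t : GrowsAtLeast (E.p * (E.j + E.α - E.m) + E.δ * E.d) fun r =>
    a (1 + E.q * (E.p * ⌊(r : ℝ) ^ κ⌋₊) + E.q * (E.p * r)) l := by
  have hα := (mem_Im.1 E.jα_mem).2
  have hμα := E.μ_lt_α
  have hsymbol := exists_eventually_symbol_le_rpow E.c_nonpos hκ1
    (k := fun r => 1 + E.q * (E.p * ⌊(r : ℝ) ^ κ⌋₊) + E.q * (E.p * r))
    (k₀ := 1) (k₁ := E.q * E.p) (k₂ := E.q * E.p)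
    (l := fun r => l + E.δ * (E.p * r)) (l₀ := l) (l₁ := 0) (l₂ := E.δ * E.p)
    (by simp [mul_assoc]) (by simp [mul_assoc])
  have hN (b : ℝ) (hb : 0 < b) :=
    growsAtLeast_pow_mul_factorial_pow hb (-E.m) E.p_pos (E.j + E.α)
  have hexp : -(E.m : ℝ) + (E.j + E.α : ℕ) = E.j + E.α - E.m := by
    push_cast
    ring
  rw [hexp] at hN
  exact growsAtLeast_t_run ha (by omega) (fun _ => by omega) (by simpa using hsymbol) hN
    (by simpa only [mul_left_comm E.p] using growsAtLeast_solution_x ha hκ1 hl hpos hκ0 hκ)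

end Path

theorem gevrey_exponents_le {M R e e' : ℝ} (hR : 1 ≤ R) (he : 0 ≤ e) (he' : 0 ≤ e')
    (hle : ∀ k l, a k l ≤ M * R ^ (k + l) * ((k ! : ℝ) ^ e * (l ! : ℝ) ^ e')) :
    (E.j + E.α + E.d / E.p * E.δ - E.m) / E.q ≤ e ∧ E.d / E.p ≤ e' := by
  obtain ⟨l, hl, hpos⟩ := exists_one_solution_pos ha
  obtain ⟨κ, hκ0, hκ1, hκ⟩ := exists_slope_of_supporting_line E.hβ_mem E.hβ_notMem
  have hx := (growsAtLeast_solution_x ha hκ1 hl hpos hκ0 hκ).le <|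
    growsAtMost_of_le_gevrey hR he he' hle hκ1
      (k₀ := 1) (k₁ := E.q * E.p) (k₂ := 0) (l₀ := l) (l₁ := 0) (l₂ := E.p * E.δ)
      (by simp [mul_assoc]) (by simp [mul_assoc])
  have ht := (growsAtLeast_solution_t ha hκ1 hl hpos hκ0 hκ).le <|
    growsAtMost_of_le_gevrey hR he he' hle hκ1
      (k₀ := 1) (k₁ := E.q * E.p) (k₂ := E.q * E.p) (l₀ := l) (l₁ := 0) (l₂ := 0)
      (by simp [mul_assoc]) (by simp)
  have hp : (0 : ℝ) < E.p := by exact_mod_cast E.p_pos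
  have hq : (0 : ℝ) < E.q := by exact_mod_cast E.q_pos
  have hδ : (0 : ℝ) < E.δ := by exact_mod_cast E.δ_pos
  push_cast at hx ht
  constructor
  · rw [div_le_iff₀ hq, ← mul_le_mul_iff_right₀ hp]
    calc E.p * (E.j + E.α + E.d / E.p * E.δ - E.m)
        = E.p * (E.j + E.α - E.m) + E.δ * E.d := by field_simp; ring
      _ ≤ E.p * (e * E.q) := by linarith
  · rw [div_le_iff₀ hp, ← mul_le_mul_iff_right₀ hδ]
    linarith

end ModelEquation

/-! ### The formal solution and its Gevrey indices -/

namespace ModelEquation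

variable (E : ModelEquation)

theorem cast_δ : (E.δ : ℝ) = E.α - E.μ := Nat.cast_sub E.μ_lt_α.le

theorem sStar_le_iff {s : ℝ} (hs : 1 ≤ s) :
    sStar E.m E.c E.p E.q E.μ E.h E.β E.j E.α ≤ s
      ↔ (E.j + E.α + E.d / E.p * E.δ - E.m) / E.q ≤ s - 1 := by
  rw [sStar, ← le_sub_iff_add_le', max_le_iff, and_iff_right (sub_nonneg.2 hs), cast_δ, d]

theorem sigmaStar_le_iff {σ : ℝ} :
    sigmaStar E.m E.c E.p E.h E.β ≤ σ ↔ E.d / E.p ≤ σ - 1 :=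
  le_sub_iff_add_le'.symm

theorem recurrence_P_ne_zero (k l : ℕ) (hk : 1 ≤ k) : E.recurrence.P k l ≠ 0 :=
  (symbol_pos E.c_nonpos hk l).ne'

/-- The formal solution of the equation. -/
def series : Series := fun n => (E.recurrence.solution (n 0) (n 1) : ℂ)

theorem cf_series (k l : ℕ) : cf E.series k l = (E.recurrence.solution k l : ℂ) :=
  cf_ofCoeffs (fun k l => (E.recurrence.solution k l : ℂ)) k l

theorem isFormalSolution_iff_eq_series {rhs : Series → Series}
    (hrhs : ∀ u k l, cf (rhs u) k l = (E.recurrence.map Complex.ofRealHom).rhs (cf u) k l)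
    {u : Series} : IsFormalSolution E.m E.c rhs u ↔ u = E.series := by
  have hP (k l : ℕ) (hk : 1 ≤ k) : (E.recurrence.map Complex.ofRealHom).P k l ≠ 0 :=
    Complex.ofReal_ne_zero.2 (E.recurrence_P_ne_zero k l hk)
  have hseries : (E.recurrence.map Complex.ofRealHom).IsSolution (cf E.series) := by
    convert (Recurrence.isSolution_solution E.recurrence_P_ne_zero).map Complex.ofRealHom using 3
    exact E.cf_series _ _
  rw [isFormalSolution_iff (fun _ _ => rfl) (fun l => by simp [Recurrence.map, recurrence]) hrhs]
  exact ⟨fun hu => series_ext fun k l => congrFun₂ (hu.unique hP hseries) k l,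
    fun hu => hu ▸ hseries⟩

theorem inGevrey_series_iff {s σ : ℝ} (hs : 1 ≤ s) (hσ : 1 ≤ σ) :
    InGevrey s σ E.series ↔ sStar E.m E.c E.p E.q E.μ E.h E.β E.j E.α ≤ s ∧
      sigmaStar E.m E.c E.p E.h E.β ≤ σ := by
  have ha := Recurrence.isSolution_solution E.recurrence_P_ne_zero
  have hnorm (k l : ℕ) : ‖cf E.series k l‖ = E.recurrence.solution k l := by
    rw [cf_series, Complex.norm_of_nonneg (solution_nonneg ha k l)]
  simp only [inGevrey_iff, hnorm, E.sStar_le_iff hs, E.sigmaStar_le_iff]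
  constructor
  · rintro ⟨M, -, R, hR, hle⟩
    exact gevrey_exponents_le ha hR (sub_nonneg.2 hs) (sub_nonneg.2 hσ) hle
  · rintro ⟨hs, hσ⟩
    obtain ⟨M, hM, R, hR, hle⟩ := exists_solution_le ha
    refine ⟨M, hM, R, hR, fun k l => (hle k l).trans ?_⟩
    gcongr <;> exact_mod_cast Nat.factorial_pos _

theorem existsUnique_formalSolution_inGevrey_iff {rhs : Series → Series}
    (hrhs : ∀ u k l, cf (rhs u) k l = (E.recurrence.map Complex.ofRealHom).rhs (cf u) k l) :
    ∃ u : Series, IsFormalSolution E.m E.c rhs u ∧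
      (∀ v : Series, IsFormalSolution E.m E.c rhs v → v = u) ∧
      ∀ s σ : ℝ, 1 ≤ s → 1 ≤ σ →
        (InGevrey s σ u ↔ sStar E.m E.c E.p E.q E.μ E.h E.β E.j E.α ≤ s ∧
          sigmaStar E.m E.c E.p E.h E.β ≤ σ) :=
  ⟨E.series, (E.isFormalSolution_iff_eq_series hrhs).2 rfl,
    fun _ => (E.isFormalSolution_iff_eq_series hrhs).1,
    fun _ _ => E.inGevrey_series_iff⟩

theorem map_recurrence_rhs (a : ℕ → ℕ → ℂ) (k l : ℕ) :
    (E.recurrence.map Complex.ofRealHom).rhs a k l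
      = E.A * (if k = 1 ∧ l = E.l₀ then 1 else 0)
        + E.B * (if E.p ≤ l then
          (k : ℂ) ^ E.h * (E.g (l - E.p) * a k (l - E.p)) else 0)
        + E.C * (if E.q ≤ k ∧ E.μ ≤ l then ((k - E.q : ℕ) : ℂ) ^ E.j
          * ((l - E.μ + E.α).descFactorial E.α * a (k - E.q) (l - E.μ + E.α)) else 0) := by
  simp only [Recurrence.rhs, Recurrence.xTerm, Recurrence.tTerm, Recurrence.map, recurrence,
    Complex.ofRealHom_eq_coe, apply_ite Complex.ofReal, Complex.ofReal_zero, mul_ite, mul_zero,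
    mul_one]
  push_cast
  simp only [mul_assoc]

theorem cf_modelRhs (hl₀ : E.l₀ = E.m)
    (hg : ∀ l, E.g l = l.descFactorial E.β) (u : Series) (k l : ℕ) :
    cf (modelRhs E.m E.A E.B E.C E.p E.q E.μ E.h E.β E.j E.α u) k l
      = (E.recurrence.map Complex.ofRealHom).rhs (cf u) k l := by
  rw [modelRhs, cf_add, cf_add, cf_smul, cf_smul, cf_smul, cf_xvar_pow_mul_tvar, cf_xvar_pow_mul,
    Module.End.mul_apply, cf_thetaT_pow, cf_fallX, cf_shift_thetaT_pow_mul_dx_pow,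
    E.map_recurrence_rhs, hl₀, hg, Complex.ofReal_natCast]

theorem cf_variantRhs (hl₀ : E.l₀ = 1) (hg : ∀ l, E.g l = (l : ℝ) ^ E.β)
    (u : Series) (k l : ℕ) :
    cf (variantRhs E.A E.B E.C E.p E.q E.μ E.h E.β E.j E.α u) k l
      = (E.recurrence.map Complex.ofRealHom).rhs (cf u) k l := by
  rw [variantRhs, ← pow_one xvar, cf_add, cf_add, cf_smul, cf_smul, cf_smul, cf_xvar_pow_mul_tvar,
    pow_one, cf_xvar_pow_mul, Module.End.mul_apply, cf_thetaT_pow, cf_thetaX_pow,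
    cf_shift_thetaT_pow_mul_dx_pow, E.map_recurrence_rhs, hl₀, hg, Complex.ofReal_pow,
    Complex.ofReal_natCast]

end ModelEquation

end FormalGevrey

end

theorem proposition5p6 (m : ℕ) (c : ℕ × ℕ → ℝ) (A B C : ℝ) (p q μ h β j α : ℕ)
    (hc : ∀ v ∈ FormalGevrey.Im m, c v ≤ 0)
    (hA : 0 < A) (hB : 0 < B) (hC : 0 < C)
    (hp : 1 ≤ p) (hq : 1 ≤ q) (hμ : μ < m)
    (hhβ : (h, β) ∈ FormalGevrey.Im m)
    (hout : ((h : ℝ), (β : ℝ)) ∉ FormalGevrey.newtonPolygon m c)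
    (hjα : (j, α) ∈ FormalGevrey.Im m) (hαμ : μ < α) :
    (∃ u : FormalGevrey.Series,
      FormalGevrey.IsFormalSolution m c
        (FormalGevrey.modelRhs m A B C p q μ h β j α) u ∧
      (∀ v : FormalGevrey.Series, FormalGevrey.IsFormalSolution m c
        (FormalGevrey.modelRhs m A B C p q μ h β j α) v → v = u) ∧
      ∀ s σ : ℝ, 1 ≤ s → 1 ≤ σ →
        (FormalGevrey.InGevrey s σ u ↔
          FormalGevrey.sStar m c p q μ h β j α ≤ s ∧
            FormalGevrey.sigmaStar m c p h β ≤ σ)) ∧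
    (∃ u : FormalGevrey.Series,
      FormalGevrey.IsFormalSolution m c
        (FormalGevrey.variantRhs A B C p q μ h β j α) u ∧
      (∀ v : FormalGevrey.Series, FormalGevrey.IsFormalSolution m c
        (FormalGevrey.variantRhs A B C p q μ h β j α) v → v = u) ∧
      ∀ s σ : ℝ, 1 ≤ s → 1 ≤ σ →
        (FormalGevrey.InGevrey s σ u ↔
          FormalGevrey.sStar m c p q μ h β j α ≤ s ∧
            FormalGevrey.sigmaStar m c p h β ≤ σ)) := by
  let E : FormalGevrey.ModelEquation :=
    { m, p, q, μ, h, β, j, α, c, A, B, C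
      l₀ := m
      g := fun l => l.descFactorial β
      c_nonpos := hc
      A_pos := hA
      B_pos := hB
      C_pos := hC
      p_pos := hp
      q_pos := hq
      hβ_mem := hhβ
      hβ_notMem := hout
      jα_mem := hjα
      μ_lt_α := hαμ
      descFactorial_le_g := fun _ => le_rfl
      g_le_pow := fun l => by exact_mod_cast Nat.descFactorial_le_pow l β
      g_pos := fun l hl => by
        have := (FormalGevrey.mem_Im.1 hhβ).2
        exact_mod_cast Nat.descFactorial_pos.2 (by omega) }
  let E' : FormalGevrey.ModelEquation :=
    { E with
      l₀ := 1
      g := fun l => (l : ℝ) ^ β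
      descFactorial_le_g := fun l => by exact_mod_cast Nat.descFactorial_le_pow l β
      g_le_pow := fun _ => le_rfl
      g_pos := fun l hl => pow_pos (by exact_mod_cast hl) β }
  exact ⟨E.existsUnique_formalSolution_inGevrey_iff (E.cf_modelRhs rfl fun _ => rfl),
    E'.existsUnique_formalSolution_inGevrey_iff (E'.cf_variantRhs rfl fun _ => rfl)⟩
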